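/- All graphs are finite, simple and undirected. Let $k\ge 1$ and let $G$ be a graph. An edge-colouring of $G$ (adjacent edges may receive the same colour) is *monochromatic $k$-connected* if any two distinct vertices $u,v$ of $G$ are connected by $k$ distinct, pairwise internally vertex-disjoint paths each of which is monochromatic, i.e. all edges of the path have the same colour (different paths may have different colours). If such a colouring exists, the *monochromatic $k$-connection number* $mc_k(G)$ is the maximum number of colours used in a monochromatic $k$-connected edge-colouring of $G$. Let $K_n$ denote the complete graph on $n$ vertices. **Theorem.** (a) Let $n>k\ge 2$ be integers. Then $mc_k(K_n)$ is well-defined (the maximum exists) and $$\binom n2-\left\lceil\frac{kn}{2}\right\rceil+1\;\le\; mc_k(K_n)\;\le\;\binom n2-\left\lceil\frac{(k-1)n(n-1)}{2(n-2)}\right\rceil+1 .$$ (b) Let $n>k$ be integers, where $k\in\{2,3,4,5\}$. Then $$mc_k(K_n)=\binom n2-\left\lceil\frac{kn}{2}\right\rceil+1 .$$ -/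

import Mathlib

namespace SimpleGraph

variable {V : Type*} {G : SimpleGraph V}

/-- A walk is monochromatic in an edge-colouring if all of its edges have the same colour. -/
def Walk.IsMonochromatic {K : Type*} (φ : G.EdgeLabeling K) {u v : V} (p : G.Walk u v) : Prop :=
  ∃ c : K, ∀ (e : Sym2 V) (he : e ∈ p.edges), φ ⟨e, p.edges_subset_edgeSet he⟩ = c

/-- Two walks from `u` to `v` are internally vertex-disjoint if they share no vertex other
than the end-vertices `u` and `v`. -/
def Walk.InternallyDisjoint {u v : V} (p q : G.Walk u v) : Prop :=
  ∀ x : V, x ∈ p.support → x ∈ q.support → x = u ∨ x = v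

/-- An edge-colouring of `G` is monochromatic `k`-connected if any two distinct vertices are
connected by `k` (distinct) pairwise internally vertex-disjoint monochromatic paths; different
paths may have different colours. -/
def EdgeLabeling.IsMonochromaticConnected {K : Type*} (φ : G.EdgeLabeling K) (k : ℕ) : Prop :=
  ∀ u v : V, u ≠ v → ∃ P : Fin k → G.Path u v,
    Function.Injective P ∧
    (∀ i j : Fin k, i ≠ j → (P i : G.Walk u v).InternallyDisjoint (P j : G.Walk u v)) ∧
    ∀ i : Fin k, (P i : G.Walk u v).IsMonochromatic φ

/-- The numbers `r` such that `G` has a monochromatic `k`-connected edge-colouring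
with exactly `r` colours. -/
def monochromaticColourCounts (G : SimpleGraph V) (k : ℕ) : Set ℕ :=
  {r | ∃ φ : G.EdgeLabeling (Fin r), Function.Surjective φ ∧ φ.IsMonochromaticConnected k}

/-- The monochromatic `k`-connection number `mc_k(G)` of a graph `G`: the maximum number of colours
in a monochromatic `k`-connected edge-colouring of `G`. -/
noncomputable def monochromaticConnectionNumber (k : ℕ) (G : SimpleGraph V) : ℕ :=
  sSup (G.monochromaticColourCounts k)

theorem bddAbove_monochromaticColourCounts [Finite V] (G : SimpleGraph V) (k : ℕ) :
    BddAbove (G.monochromaticColourCounts k) := by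
  refine ⟨Nat.card G.edgeSet, ?_⟩
  rintro r ⟨φ, hφ, -⟩
  simpa using Nat.card_le_card_of_surjective (α := G.edgeSet) φ hφ

/-- On a finite graph that has a monochromatic `k`-connected colouring, the supremum defining
`mc_k(G)` is a maximum. -/
theorem isGreatest_monochromaticConnectionNumber [Finite V] (G : SimpleGraph V) (k : ℕ)
    (h : (G.monochromaticColourCounts k).Nonempty) :
    IsGreatest (G.monochromaticColourCounts k) (monochromaticConnectionNumber k G) :=
  ⟨Nat.sSup_mem h (bddAbove_monochromaticColourCounts G k),
    fun _ hr => le_csSup (bddAbove_monochromaticColourCounts G k) hr⟩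

end SimpleGraph

section

open Finset
open scoped Classical

set_option linter.unusedSectionVars false

namespace MonochromaticCover

section

variable {V ι : Type*} [Fintype V] [Fintype ι]

/-! ### An inequality for functions on rooted trees -/

/-! Lower bound: one colour is given to a graph with at most ⌈kn/2⌉ edges in which any two vertices
are joined by `k` disjoint paths, and a private colour to every other edge. The graph is a power of
a cycle, with longest diagonals added for odd `k` (`exists_isExpanding`); Hall's theorem turns its
expansion into paths (`exists_disjoint_paths`).

Upper bound: let G_1, ..., G_p be the components with at least two edges of the colour classes.
There are at most C(n,2) − Σ(e(G_i) − 1) colours, so the sum of all degrees d_i(v) has to be bounded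
below in terms of p. For an edge uv of some G_i, the k − 1 indirect paths and the edge itself give k
≤ Σ_i min(d_i(u), d_i(v)) (`le_sum_min`). Summed along a spanning tree of the union, these minima
contribute k(n − 1). What remains of each d_i is its root value plus its increases from parent to
child, which is at least the maximum degree Δ_i. Hence Σ d_i(v) ≥ k(n − 1) + Σ Δ_i
(`sum_degree_ge`). All Δ_i are at least 2, and counting paths of length two makes one of them at
least 2k + 1 − n, which proves (a).

For k ≤ 5 the target is kn + 2p − 2. If a level set {d_i > l} is not all of V, the tree can be
chosen with up to k − 2 vertices of that set as leaves hanging from outside it, and each leaf gains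
one (`sum_degree_ge_of_level`). So in a counterexample all proper level sets are small
(`card_level_le`). The non-isolated vertices of a class number at least three, so the classes span V
except in one special case. A class of maximum degree two that spans V is a cycle and carries only
one path of a system of three, and counting then gives a contradiction. -/

/-- A rooted tree on `V` in which all members of `J` are leaves, given by its parent map. -/
structure RootedTree (J : Finset V) where
  root : V
  par : V → V
  rank : V → ℕ
  rank_par : ∀ v, v ≠ root → rank (par v) < rank v
  par_notMem : ∀ v, v ≠ root → par v ∉ J

variable {J : Finset V}

/-- A vertex of minimal rank in `X \ J'` works: its parent is no leaf and has smaller rank, so it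
cannot lie in `X`. -/
theorem RootedTree.exists_exit (T : RootedTree J) (X : Finset V) (hr : T.root ∉ X) (J' : Finset V)
    (hJ' : J' ⊆ J) {x : V} (hx : x ∈ X) (hxJ : x ∉ J') :
    ∃ v ∈ X, v ∉ J' ∧ v ≠ T.root ∧ T.par v ∉ X := by
  obtain ⟨v, hv, hmin⟩ := (X \ J').exists_min_image T.rank ⟨x, by simp [hx, hxJ]⟩
  rw [mem_sdiff] at hv
  have hvr : v ≠ T.root := fun h => hr (h ▸ hv.1)
  refine ⟨v, hv.1, hv.2, hvr, fun hpv => ?_⟩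
  have := hmin (T.par v) (mem_sdiff.2 ⟨hpv, fun h => T.par_notMem v hvr (hJ' h)⟩)
  exact absurd (T.rank_par v hvr) (by omega)

/-- The vertices of the set `{v | l < d v}` whose parent is not in this set. -/
noncomputable def RootedTree.exits (T : RootedTree J) (d : V → ℕ) (l : ℕ) : Finset V :=
  {v | v ≠ T.root ∧ l < d v ∧ d (T.par v) ≤ l}

/-- Layer-cake summation: an increase from parent to child counts the levels at which the child is
an exit. -/
theorem RootedTree.sum_sub_eq (T : RootedTree J) (d : V → ℕ) (D : ℕ) (hD : ∀ v, d v ≤ D) :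
    ∑ v ∈ univ.erase T.root, (d v - d (T.par v)) = ∑ l ∈ range D, #(T.exits d l) := by
  have h1 : ∀ v, d v - d (T.par v) = ∑ l ∈ range D, if l < d v ∧ d (T.par v) ≤ l then 1 else 0 := by
    intro v
    rw [← card_filter, ← Nat.card_Ico]
    congr 1
    ext l
    simp only [mem_Ico, mem_filter, mem_range]
    have := hD v
    constructor <;> intro h <;> omega
  simp_rw [h1]
  rw [sum_comm]
  refine sum_congr rfl fun l _ => ?_
  rw [← card_filter]
  congr 1
  ext v
  simp [RootedTree.exits]

theorem RootedTree.one_le_card_exits (T : RootedTree J) (d : V → ℕ) (l : ℕ) (hr : d T.root ≤ l)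
    {w : V} (hw : l < d w) : 1 ≤ #(T.exits d l) := by
  obtain ⟨v, hv, -, hvr, hp⟩ := T.exists_exit {v | l < d v} (by simpa using hr) ∅ (by simp)
    (x := w) (by simpa using hw) (by simp)
  refine card_pos.2 ⟨v, ?_⟩
  simp only [mem_filter, mem_univ, true_and, not_lt] at hv hp
  simp [RootedTree.exits, hv, hp, hvr]

theorem RootedTree.le_add_sum_sub (T : RootedTree J) (d : V → ℕ) {w : V} (hw : ∀ v, d v ≤ d w) :
    d w ≤ d T.root + ∑ v ∈ univ.erase T.root, (d v - d (T.par v)) := by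
  rw [T.sum_sub_eq d (d w) hw]
  calc d w = d T.root + #(Ico (d T.root) (d w)) := by
        have := hw T.root; simp; omega
    _ ≤ d T.root + ∑ l ∈ Ico (d T.root) (d w), #(T.exits d l) := by
        gcongr
        rw [card_eq_sum_ones]
        refine sum_le_sum fun l hl => ?_
        rw [mem_Ico] at hl
        exact T.one_le_card_exits d l hl.1 hl.2
    _ ≤ _ := by
        gcongr
        intro l hl
        rw [mem_Ico] at hl
        exact mem_range.2 hl.2

/-- One exit at every level between the root value and the maximum already gives `d w`. At level `l`
all of `J` exits as well, besides an exit outside `J`. -/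
theorem RootedTree.le_add_sum_sub_of_leaves (T : RootedTree J) (d : V → ℕ) {w : V}
    (hw : ∀ v, d v ≤ d w) {l : ℕ} (hr : d T.root ≤ l) (hJ : ∀ x ∈ J, l < d x)
    (hpar : ∀ x ∈ J, d (T.par x) ≤ l) {x : V} (hx : l < d x) (hxJ : x ∉ J) :
    d w + #J ≤ d T.root + ∑ v ∈ univ.erase T.root, (d v - d (T.par v)) := by
  rw [T.sum_sub_eq d (d w) hw]
  have hl : l ∈ Ico (d T.root) (d w) := mem_Ico.2 ⟨hr, hx.trans_le (hw x)⟩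
  have hJr : ∀ y ∈ J, y ≠ T.root := fun y hy h => by
    have := hJ y hy; rw [h] at this; omega
  have hexit : 1 + #J ≤ #(T.exits d l) := by
    obtain ⟨v, hv, hvJ, hvr, hp⟩ := T.exists_exit {v | l < d v} (by simpa using hr) J subset_rfl
      (x := x) (by simpa using hx) hxJ
    simp only [mem_filter, mem_univ, true_and, not_lt] at hv hp
    rw [add_comm, ← card_insert_of_notMem hvJ]
    refine card_le_card fun y hy => ?_
    rcases mem_insert.1 hy with rfl | hy
    · simp [RootedTree.exits, hv, hp, hvr]
    · simp [RootedTree.exits, hJ y hy, hpar y hy, hJr y hy]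
  have hcard : d w = d T.root + #(Ico (d T.root) (d w)) := by
    have := hw T.root; simp; omega
  have hsplit : #(Ico (d T.root) (d w)) + #J ≤ ∑ l ∈ Ico (d T.root) (d w), #(T.exits d l) := by
    rw [← add_sum_erase _ _ hl, ← card_erase_add_one hl, card_eq_sum_ones]
    have : ∑ m ∈ (Ico (d T.root) (d w)).erase l, 1
        ≤ ∑ m ∈ (Ico (d T.root) (d w)).erase l, #(T.exits d m) := by
      refine sum_le_sum fun m hm => ?_
      rw [mem_erase, mem_Ico] at hm
      exact T.one_le_card_exits d m hm.2.1 hm.2.2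
    omega
  have hsub : ∑ l ∈ Ico (d T.root) (d w), #(T.exits d l) ≤ ∑ l ∈ range (d w), #(T.exits d l) := by
    refine sum_le_sum_of_subset fun l hl => ?_
    rw [mem_Ico] at hl
    exact mem_range.2 hl.2
  omega

/-- Each value splits into its minimum with the parent value and its increase over it; the minima
are summed over `i` first, the increases over `v` first. -/
theorem RootedTree.sum_sum_le (T : RootedTree J) (d : ι → V → ℕ) (k : ℕ)
    (hk : ∀ v, v ≠ T.root → k ≤ ∑ i, min (d i v) (d i (T.par v))) (b : ι → ℕ)
    (hb : ∀ i, b i ≤ d i T.root + ∑ v ∈ univ.erase T.root, (d i v - d i (T.par v))) :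
    (Fintype.card V - 1) * k + ∑ i, b i ≤ ∑ i, ∑ v, d i v := by
  have h1 : ∀ i, ∑ v, d i v = d i T.root + ∑ v ∈ univ.erase T.root, (d i v - d i (T.par v)) +
      ∑ v ∈ univ.erase T.root, min (d i v) (d i (T.par v)) := by
    intro i
    rw [← add_sum_erase _ _ (mem_univ T.root), add_assoc, ← sum_add_distrib]
    congr 1
    exact sum_congr rfl fun v _ => by omega
  simp_rw [h1]
  rw [sum_add_distrib, add_comm]
  refine Nat.add_le_add (sum_le_sum fun i _ => hb i) ?_
  rw [sum_comm]
  calc (Fintype.card V - 1) * k = ∑ v ∈ univ.erase T.root, k := by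
        rw [sum_const, card_erase_of_mem (mem_univ _), card_univ, smul_eq_mul]
    _ ≤ _ := sum_le_sum fun v hv => hk v (ne_of_mem_erase hv)

end

/-! ### Covers and the degree sum along a spanning tree -/

section

variable {V ι : Type*} [Fintype V] [Fintype ι]

/-- A family of pairwise edge-disjoint graphs, each with at least two edges and connected apart
from isolated vertices, such that any two vertices are joined by `k - 1` internally disjoint
indirect paths each of which lies in one of the graphs. -/
structure IsCover (G : ι → SimpleGraph V) (k : ℕ) : Prop where
  disjoint : ∀ i j u v, (G i).Adj u v → (G j).Adj u v → i = j
  reachable : ∀ i u v u' v', (G i).Adj u u' → (G i).Adj v v' → (G i).Reachable u v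
  two_le_degree : ∀ i, ∃ u, 2 ≤ (G i).degree u
  paths : ∀ u v, u ≠ v → ∃ (I : Fin (k - 1) → ι) (p : ∀ j, (G (I j)).Walk u v),
    (∀ j, (p j).IsPath ∧ 2 ≤ (p j).length) ∧
    ∀ j j', j ≠ j' → ∀ x, x ∈ (p j).support → x ∈ (p j').support → x = u ∨ x = v

theorem _root_.SimpleGraph.Walk.IsPath.snd_ne {G : SimpleGraph V} {u v : V} {p : G.Walk u v}
    (hp : p.IsPath) (h : 2 ≤ p.length) : p.snd ≠ u ∧ p.snd ≠ v := by
  have hinj := hp.getVert_injOn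
  constructor <;> intro h1
  · have := hinj (x₁ := 1) (x₂ := 0) (by simp; omega) (by simp) (by simpa using h1)
    omega
  · have := hinj (x₁ := 1) (x₂ := p.length) (by simp; omega) (by simp) (by simpa using h1)
    omega

theorem _root_.SimpleGraph.Walk.IsPath.penultimate_ne {G : SimpleGraph V} {u v : V}
    {p : G.Walk u v} (hp : p.IsPath) (h : 2 ≤ p.length) :
    p.penultimate ≠ u ∧ p.penultimate ≠ v := by
  have hinj := hp.getVert_injOn
  constructor <;> intro h1
  · have := hinj (x₁ := p.length - 1) (x₂ := 0) (by simp) (by simp) (by simpa using h1)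
    omega
  · have := hinj (x₁ := p.length - 1) (x₂ := p.length) (by simp) (by simp) (by simpa using h1)
    omega

theorem _root_.SimpleGraph.Walk.not_nil_of_two_le {G : SimpleGraph V} {u v : V}
    {p : G.Walk u v} (h : 2 ≤ p.length) : ¬ p.Nil := by
  rw [SimpleGraph.Walk.not_nil_iff_lt_length]; omega

namespace IsCover

variable {G : ι → SimpleGraph V} {k : ℕ}

/-- The number of paths in a given graph is bounded by the degrees of the ends. -/
theorem exists_count (hG : IsCover G k) {u v : V} (huv : u ≠ v) :
    ∃ (I : Fin (k - 1) → ι) (p : ∀ j, (G (I j)).Walk u v),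
      (∀ j, (p j).IsPath ∧ 2 ≤ (p j).length) ∧
      (∀ j j', j ≠ j' → ∀ x, x ∈ (p j).support → x ∈ (p j').support → x = u ∨ x = v) ∧
      ∀ i, #{j | I j = i} + (if (G i).Adj u v then 1 else 0) ≤
        min ((G i).degree u) ((G i).degree v) := by
  obtain ⟨I, p, hp, hdis⟩ := hG.paths u v huv
  refine ⟨I, p, hp, hdis, fun i => le_min ?_ ?_⟩
  -- The second vertices of the paths are distinct neighbours of `u` other than `v`, which leaves
  -- room for the edge `uv`.
  · have hmap : #{j | I j = i} ≤ #(((G i).neighborFinset u).erase v) := by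
      refine card_le_card_of_injOn (fun j => (p j).snd) ?_ ?_
      · intro j hj
        have hj : I j = i := by simpa using hj
        have h1 := (p j).adj_snd (SimpleGraph.Walk.not_nil_of_two_le (hp j).2)
        simp only [coe_erase, Set.mem_sdiff, mem_coe, SimpleGraph.mem_neighborFinset,
          Set.mem_singleton_iff]
        exact ⟨hj ▸ h1, ((hp j).1.snd_ne (hp j).2).2⟩
      · intro j _ j' _ h
        by_contra hne
        have h1 := (hp j).1.snd_ne (hp j).2
        rcases hdis j j' hne (p j).snd ((p j).getVert_mem_support _)
          (by simp only at h; rw [h]; exact ((p j').getVert_mem_support _)) with h2 | h2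
        exacts [h1.1 h2, h1.2 h2]
    split_ifs with h
    · rw [card_erase_of_mem (by simpa using h), SimpleGraph.card_neighborFinset_eq_degree] at hmap
      have : 0 < (G i).degree u := (SimpleGraph.degree_pos_iff_exists_adj _ _).2 ⟨v, h⟩
      omega
    · rw [erase_eq_of_notMem (by simpa using h), SimpleGraph.card_neighborFinset_eq_degree] at hmap
      omega
  · have hmap : #{j | I j = i} ≤ #(((G i).neighborFinset v).erase u) := by
      refine card_le_card_of_injOn (fun j => (p j).penultimate) ?_ ?_
      · intro j hj
        have hj : I j = i := by simpa using hj
        have h1 := (p j).adj_penultimate (SimpleGraph.Walk.not_nil_of_two_le (hp j).2)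
        simp only [coe_erase, Set.mem_sdiff, mem_coe, SimpleGraph.mem_neighborFinset,
          Set.mem_singleton_iff]
        exact ⟨hj ▸ h1.symm, ((hp j).1.penultimate_ne (hp j).2).1⟩
      · intro j _ j' _ h
        by_contra hne
        have h1 := (hp j).1.penultimate_ne (hp j).2
        rcases hdis j j' hne (p j).penultimate ((p j).getVert_mem_support _)
          (by simp only at h; rw [h]; exact ((p j').getVert_mem_support _)) with h2 | h2
        exacts [h1.1 h2, h1.2 h2]
    split_ifs with h
    · rw [card_erase_of_mem (by simpa using h.symm), SimpleGraph.card_neighborFinset_eq_degree]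
        at hmap
      have : 0 < (G i).degree v := (SimpleGraph.degree_pos_iff_exists_adj _ _).2 ⟨u, h.symm⟩
      omega
    · rw [erase_eq_of_notMem (by simpa [SimpleGraph.adj_comm] using h),
        SimpleGraph.card_neighborFinset_eq_degree] at hmap
      omega

theorem sum_card_fiber (I : Fin (k - 1) → ι) : ∑ i, #{j | I j = i} = k - 1 := by
  simpa using (card_eq_sum_card_fiberwise (f := I) (s := univ) (t := univ) (fun _ _ => by simp)).symm

theorem le_sum_min (hG : IsCover G k) {i : ι} {u v : V} (h : (G i).Adj u v) :
    k ≤ ∑ i, min ((G i).degree u) ((G i).degree v) := by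
  obtain ⟨I, p, -, -, hc⟩ := hG.exists_count h.ne
  have h1 := sum_le_sum fun i (_ : i ∈ univ) => hc i
  rw [sum_add_distrib, sum_card_fiber] at h1
  have h2 : 1 ≤ ∑ i, (if (G i).Adj u v then 1 else 0) :=
    le_trans (by simp [h]) (single_le_sum (f := fun i => if (G i).Adj u v then 1 else 0)
      (by intros; positivity) (mem_univ i))
  omega

/-- Each vertex of `S` blocks at most one of the `k - 1` disjoint paths, so at least one survives.
-/
theorem reachable_avoiding (hG : IsCover G k) {S : Finset V} (hS : #S + 2 ≤ k) {u v : V}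
    (hu : u ∉ S) (hv : v ∉ S) :
    ∃ p : (⨆ i, G i).Walk u v, ∀ x ∈ p.support, x ∉ S := by
  rcases eq_or_ne u v with rfl | huv
  · exact ⟨.nil, by simpa using hu⟩
  obtain ⟨I, p, hp, hdis⟩ := hG.paths u v huv
  by_contra hcon
  have hex : ∀ j, ∃ x ∈ (p j).support, x ∈ S := by
    intro j
    by_contra! h
    exact hcon ⟨(p j).mapLe (le_iSup G (I j)), by simpa using h⟩
  choose f hf hfS using hex
  have hinj : Function.Injective f := by
    intro j j' h
    by_contra hne
    rcases hdis j j' hne (f j) (hf j) (h ▸ hf j') with h1 | h1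
    · exact hu (h1 ▸ hfS j)
    · exact hv (h1 ▸ hfS j)
  have := card_le_card_of_injOn (s := univ) (t := S) f (fun j _ => hfS j) hinj.injOn
  simp at this
  omega

/-- A rooted spanning tree of the union in which a given small set consists of leaves. -/
theorem exists_rootedTree (hG : IsCover G k) {S : Finset V} (hS : #S + 2 ≤ k) {r : V}
    (hr : r ∉ S) (g : V → V) (hg : ∀ x ∈ S, (⨆ i, G i).Adj x (g x) ∧ g x ∉ S) :
    ∃ T : RootedTree S, T.root = r ∧ (∀ x ∈ S, T.par x = g x) ∧
      ∀ v, v ≠ r → (⨆ i, G i).Adj v (T.par v) := by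
  -- The union without `S` is still connected. Outside `S` the tree follows shortest paths in it
  -- towards `r`, and `S` is attached by `g`.
  let H : SimpleGraph V := (⨆ i, G i) ⊓ SimpleGraph.mk (fun a b => a ≠ b ∧ a ∉ S ∧ b ∉ S)
    ⟨fun a b h => ⟨h.1.symm, h.2.2, h.2.1⟩⟩ ⟨fun a h => h.1 rfl⟩
  have hreach : ∀ v, v ∉ S → H.Reachable v r := by
    intro v hv
    obtain ⟨p, hp⟩ := hG.reachable_avoiding hS hv hr
    refine ⟨p.transfer H fun e he => ?_⟩
    induction e with | _ a b =>
    exact ⟨p.adj_of_mem_edges he, (p.adj_of_mem_edges he).ne,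
      hp _ (p.fst_mem_support_of_mem_edges he), hp _ (p.snd_mem_support_of_mem_edges he)⟩
  have hstep : ∀ v, v ∉ S → v ≠ r → ∃ w, H.Adj v w ∧ H.dist w r < H.dist v r := by
    intro v hv hvr
    obtain ⟨p, hp⟩ := (hreach v hv).exists_walk_length_eq_dist
    cases p with
    | nil => exact absurd rfl hvr
    | cons h q =>
      refine ⟨_, h, ?_⟩
      have := SimpleGraph.dist_le q
      rw [SimpleGraph.Walk.length_cons] at hp
      omega
  choose! f hf using hstep
  refine ⟨⟨r, fun v => if v ∈ S then g v else f v,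
    -- A rank above all distances, so that a vertex of `S` ranks above its parent.
    fun v => if v ∈ S then 1 + ∑ w, H.dist w r else H.dist v r, ?_, ?_⟩, rfl, ?_, ?_⟩
  · intro v hvr
    by_cases hv : v ∈ S
    · simp only [hv, if_true, (hg v hv).2, if_false]
      have := single_le_sum (f := fun w => H.dist w r) (fun _ _ => Nat.zero_le _)
        (mem_univ (g v))
      omega
    · simp only [hv, if_false, (hf v hv hvr).1.2.2.2]
      exact (hf v hv hvr).2
  · intro v hvr
    by_cases hv : v ∈ S
    · simpa [hv] using (hg v hv).2
    · simpa [hv] using (hf v hv hvr).1.2.2.2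
  · intro x hx; simp [hx]
  · intro v hvr
    by_cases hv : v ∈ S
    · simpa [hv] using (hg v hv).1
    · simpa [hv] using (hf v hv hvr).1.1

theorem sum_degree_ge (hG : IsCover G k) (hk : 2 ≤ k) [Nonempty V] :
    (Fintype.card V - 1) * k + ∑ i, (G i).maxDegree ≤ ∑ i, ∑ v, (G i).degree v := by
  obtain ⟨T, hTr, -, hT⟩ := hG.exists_rootedTree (S := ∅) (by simpa using hk)
    (r := Classical.arbitrary V) (by simp) id (by simp)
  refine T.sum_sum_le (fun i v => (G i).degree v) k ?_ _ ?_
  · intro v hv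
    obtain ⟨i, hi⟩ := (SimpleGraph.iSup_adj).1 (hT v (hTr ▸ hv))
    exact hG.le_sum_min hi
  · intro i
    obtain ⟨w, hw⟩ := (G i).exists_maximal_degree_vertex
    rw [hw]
    exact T.le_add_sum_sub (fun v => (G i).degree v)
      fun v => hw ▸ (G i).degree_le_maxDegree v

/-- If fewer than `j` vertices of `X` had neighbours outside, deleting them would separate a
remaining vertex of `X` from `y`. -/
theorem exists_boundary (hG : IsCover G k) {X : Finset V} {y : V} (hy : y ∉ X) {j : ℕ}
    (hj : j + 2 ≤ k) (hX : j + 1 ≤ #X) :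
    ∃ S ⊆ X, #S = j ∧ ∀ x ∈ S, ∃ z ∉ X, (⨆ i, G i).Adj x z := by
  let B : Finset V := {x ∈ X | ∃ z ∉ X, (⨆ i, G i).Adj x z}
  have hB : j ≤ #B := by
    by_contra! hlt
    obtain ⟨x, hx, hxB⟩ := exists_mem_notMem_of_card_lt_card (s := B) (t := X) (by omega)
    obtain ⟨p, hp⟩ := hG.reachable_avoiding (S := B) (by omega) hxB (v := y)
      (fun h => hy (mem_filter.1 h).1)
    obtain ⟨e, he, h1, h2⟩ := p.exists_boundary_dart (X : Set V) (by simpa using hx)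
      (by simpa using hy)
    refine hp e.fst (p.dart_fst_mem_support_of_mem_darts he) ?_
    exact mem_filter.2 ⟨by simpa using h1, e.snd, by simpa using h2, e.adj⟩
  obtain ⟨S, hSB, hS⟩ := exists_subset_card_eq hB
  exact ⟨S, fun x hx => (mem_filter.1 (hSB hx)).1, hS, fun x hx => (mem_filter.1 (hSB hx)).2⟩

/-- The set of vertices of degree more than `l` in `G i`. -/
noncomputable def level (G : ι → SimpleGraph V) (i : ι) (l : ℕ) : Finset V :=
  {v | l < (G i).degree v}

theorem mem_level {i : ι} {l : ℕ} {v : V} : v ∈ level G i l ↔ l < (G i).degree v := by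
  simp [level]

/-- The tree is rooted outside the level set and has `j` boundary vertices of the level set as
leaves with parents outside; they are the extra exits at level `l`. -/
theorem sum_degree_ge_of_level (hG : IsCover G k) {i₀ : ι} {l : ℕ} (hX : level G i₀ l ≠ univ)
    {j : ℕ} (hj : j + 2 ≤ k) (hjX : j + 1 ≤ #(level G i₀ l)) :
    (Fintype.card V - 1) * k + ∑ i, (G i).maxDegree + j ≤ ∑ i, ∑ v, (G i).degree v := by
  obtain ⟨y, hy⟩ : ∃ y, y ∉ level G i₀ l := by
    by_contra! h
    exact hX (eq_univ_iff_forall.2 h)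
  have : Nonempty V := ⟨y⟩
  obtain ⟨S, hSX, hSj, hS⟩ := hG.exists_boundary hy hj hjX
  choose! g hg using hS
  obtain ⟨T, hTr, hTS, hT⟩ := hG.exists_rootedTree (S := S) (by omega) (r := y)
    (fun h => hy (hSX h)) g (fun x hx => ⟨(hg x hx).2, fun h => (hg x hx).1 (hSX h)⟩)
  obtain ⟨x, hx, hxS⟩ := exists_mem_notMem_of_card_lt_card (s := S) (t := level G i₀ l) (by omega)
  have key := T.sum_sum_le (fun i v => (G i).degree v) k (fun v hv => by
    obtain ⟨i, hi⟩ := (SimpleGraph.iSup_adj).1 (hT v (hTr ▸ hv))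
    exact hG.le_sum_min hi) (fun i => (G i).maxDegree + if i = i₀ then j else 0) (fun i => by
    obtain ⟨w, hw⟩ := (G i).exists_maximal_degree_vertex
    have hmax : ∀ v, (G i).degree v ≤ (G i).degree w := fun v => hw ▸ (G i).degree_le_maxDegree v
    rw [hw]
    split_ifs with hi
    · subst hi
      rw [← hSj]
      refine T.le_add_sum_sub_of_leaves (fun v => (G i).degree v) hmax (l := l) ?_
        (fun x hx => mem_level.1 (hSX hx)) (fun x hx => ?_) (mem_level.1 hx) hxS
      · rw [hTr]; exact not_lt.1 fun h => hy (mem_level.2 h)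
      · rw [hTS x hx]; exact not_lt.1 fun h => (hg x hx).1 (mem_level.2 h)
    · exact T.le_add_sum_sub (fun v => (G i).degree v) hmax)
  rw [sum_add_distrib, sum_ite_eq' univ i₀] at key
  simpa [add_assoc] using key

end IsCover

end

/-! ### Counting short paths, and the bound for general `k` -/

section

variable {V ι : Type*} [Fintype V] [Fintype ι]

/-- The middle vertices of the paths of length two from `u` to `v` in one of the graphs. -/
noncomputable def middles (G : ι → SimpleGraph V) (u v : V) : Finset V :=
  {w | ∃ i, (G i).Adj u w ∧ (G i).Adj w v}

/-- Two internally disjoint paths in a connected `2`-regular graph cover all vertices. -/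
theorem mem_support_of_two_regular {H H' : SimpleGraph V} (hHH : H' = H)
    (hconn : ∀ a b, H.Reachable a b) (hreg : ∀ a, H.degree a = 2) {u v : V} {p : H.Walk u v}
    {q : H'.Walk u v} (hp : p.IsPath ∧ 2 ≤ p.length) (hq : q.IsPath ∧ 2 ≤ q.length)
    (hpq : ∀ x, x ∈ p.support → x ∈ q.support → x = u ∨ x = v) (x : V) :
    x ∈ p.support ∨ x ∈ q.support := by
  -- The two paths come from a family whose graph indices agree only propositionally.
  subst hHH
  have hnb : ∀ a b c d, H'.Adj a b → H'.Adj a c → b ≠ c → H'.Adj a d → d = b ∨ d = c := by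
    intro a b c d hb hc hbc hd
    have h1 : ({b, c} : Finset V) ⊆ H'.neighborFinset a := by
      intro y hy
      rcases mem_insert.1 hy with rfl | hy
      · simpa using hb
      · rw [mem_singleton] at hy; subst hy; simpa using hc
    have h2 := eq_of_subset_of_card_le h1 (by
      rw [SimpleGraph.card_neighborFinset_eq_degree, hreg, card_pair hbc])
    have h3 : d ∈ H'.neighborFinset a := by simpa using hd
    rw [← h2] at h3
    simpa using h3
  have hint : ∀ {r : H'.Walk u v}, r.IsPath → ∀ a ∈ r.support, a ≠ u → a ≠ v →
      ∀ b, H'.Adj a b → b ∈ r.support := by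
    intro r hr a ha hau hav b hab
    obtain ⟨m, rfl, hm⟩ := SimpleGraph.Walk.mem_support_iff_exists_getVert.1 ha
    have hm0 : m ≠ 0 := by rintro rfl; simp at hau
    have hml : m ≠ r.length := by rintro rfl; simp at hav
    have h1 : H'.Adj (r.getVert m) (r.getVert (m + 1)) := r.adj_getVert_succ (by omega)
    have h2 : H'.Adj (r.getVert m) (r.getVert (m - 1)) := by
      have := r.adj_getVert_succ (i := m - 1) (by omega)
      rw [show m - 1 + 1 = m by omega] at this
      exact this.symm
    have hne : r.getVert (m + 1) ≠ r.getVert (m - 1) := by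
      intro h
      have := hr.getVert_injOn (x₁ := m + 1) (x₂ := m - 1) (by simp; omega) (by simp; omega) h
      omega
    rcases hnb _ _ _ b h1 h2 hne hab with rfl | rfl <;> exact r.getVert_mem_support _
  -- An inner vertex has both its neighbours on its own path, and each end has one neighbour on each
  -- path. So the covered set is closed under adjacency.
  have hclosed : ∀ a b, (a ∈ p.support ∨ a ∈ q.support) → H'.Adj a b →
      (b ∈ p.support ∨ b ∈ q.support) := by
    intro a b ha hab
    rcases eq_or_ne a u with rfl | hau
    · have hne : p.snd ≠ q.snd := fun h => by
        have h1 := hp.1.snd_ne hp.2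
        rcases hpq p.snd (p.getVert_mem_support _) (h ▸ q.getVert_mem_support _) with h2 | h2
        exacts [h1.1 h2, h1.2 h2]
      rcases hnb a _ _ b (p.adj_snd (SimpleGraph.Walk.not_nil_of_two_le hp.2))
        (q.adj_snd (SimpleGraph.Walk.not_nil_of_two_le hq.2)) hne hab with rfl | rfl
      · exact Or.inl (p.getVert_mem_support _)
      · exact Or.inr (q.getVert_mem_support _)
    rcases eq_or_ne a v with rfl | hav
    · have hne : p.penultimate ≠ q.penultimate := fun h => by
        have h1 := hp.1.penultimate_ne hp.2
        rcases hpq p.penultimate (p.getVert_mem_support _) (h ▸ q.getVert_mem_support _)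
          with h2 | h2
        exacts [h1.1 h2, h1.2 h2]
      rcases hnb a _ _ b (p.adj_penultimate (SimpleGraph.Walk.not_nil_of_two_le hp.2)).symm
        (q.adj_penultimate (SimpleGraph.Walk.not_nil_of_two_le hq.2)).symm hne hab with rfl | rfl
      · exact Or.inl (p.getVert_mem_support _)
      · exact Or.inr (q.getVert_mem_support _)
    · exact ha.imp (fun h => hint hp.1 a h hau hav b hab) (fun h => hint hq.1 a h hau hav b hab)
  by_contra hx
  obtain ⟨r⟩ := hconn u x
  obtain ⟨e, -, h1, h2⟩ := r.exists_boundary_dart {y | y ∈ p.support ∨ y ∈ q.support}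
    (Or.inl p.start_mem_support) hx
  exact h2 (hclosed _ _ h1 e.adj)

namespace IsCover

variable {G : ι → SimpleGraph V} {k : ℕ}

/-- Double counting of the paths of length two from `u`: each of the n − 1 possible middles lies
with `u` in at most one class and has at most `D - 1` continuations, while there are n − 1 possible
ends. -/
theorem card_middles_le (hG : IsCover G k) (hn : 2 ≤ Fintype.card V) (u : V) {D : ℕ}
    (hD : ∀ i, (G i).maxDegree ≤ D) (hD1 : 1 ≤ D) : ∃ v ≠ u, #(middles G u v) + 1 ≤ D := by
  by_contra! hcon
  have h1 : ∑ v ∈ univ.erase u, D ≤ ∑ v ∈ univ.erase u, #(middles G u v) :=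
    sum_le_sum fun v hv => by have := hcon v (ne_of_mem_erase hv); omega
  have h2 : ∑ v ∈ univ.erase u, #(middles G u v) =
      ∑ w, #{v ∈ univ.erase u | ∃ i, (G i).Adj u w ∧ (G i).Adj w v} := by
    simp_rw [middles, card_filter]
    exact sum_comm
  have h3 : ∀ w, #{v ∈ univ.erase u | ∃ i, (G i).Adj u w ∧ (G i).Adj w v} ≤ D - 1 := by
    intro w
    by_cases hw : ∃ i, (G i).Adj u w
    · obtain ⟨i, hi⟩ := hw
      have hsub : ({v ∈ univ.erase u | ∃ i, (G i).Adj u w ∧ (G i).Adj w v} : Finset V) ⊆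
          ((G i).neighborFinset w).erase u := by
        intro v hv
        simp only [mem_filter, mem_erase, mem_univ, and_true] at hv
        obtain ⟨hvu, i', h1, h2⟩ := hv
        obtain rfl := hG.disjoint i i' _ _ hi h1
        simpa [hvu] using h2
      refine (card_le_card hsub).trans ?_
      rw [card_erase_of_mem (by simpa using hi.symm), SimpleGraph.card_neighborFinset_eq_degree]
      have := ((G i).degree_le_maxDegree w).trans (hD i)
      omega
    · rw [filter_false_of_mem]
      · simp
      · rintro v - ⟨i, hi, -⟩
        exact hw ⟨i, hi⟩
  have h4 : #{v ∈ univ.erase u | ∃ i, (G i).Adj u u ∧ (G i).Adj u v} = 0 := by simp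
  rw [h2, ← add_sum_erase _ _ (mem_univ u), h4, zero_add] at h1
  have h5 := h1.trans (sum_le_sum fun w _ => h3 w)
  rw [sum_const, sum_const, card_erase_of_mem (mem_univ u), card_univ, smul_eq_mul,
    smul_eq_mul] at h5
  have := Nat.le_of_mul_le_mul_left h5 (by omega)
  omega

theorem card_length_two_le {u v : V} {I : Fin (k - 1) → ι}
    {p : ∀ j, (G (I j)).Walk u v} (hp : ∀ j, (p j).IsPath ∧ 2 ≤ (p j).length)
    (hdis : ∀ j j', j ≠ j' → ∀ x, x ∈ (p j).support → x ∈ (p j').support → x = u ∨ x = v) :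
    #{j | (p j).length = 2} ≤ #(middles G u v) := by
  refine card_le_card_of_injOn (fun j => (p j).snd) ?_ ?_
  · intro j hj
    have hj : (p j).length = 2 := by simpa using hj
    have h1 := (p j).adj_getVert_succ (i := 0) (by omega)
    have h2 := (p j).adj_getVert_succ (i := 1) (by omega)
    have h3 : (p j).getVert 2 = v := by rw [← hj]; simp
    simp only [zero_add, SimpleGraph.Walk.getVert_zero, Nat.reduceAdd] at h1 h2
    rw [h3] at h2
    simp only [middles, coe_filter, mem_univ, true_and, Set.mem_ofPred_eq]
    exact ⟨I j, h1, h2⟩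
  · intro j _ j' _ h
    by_contra hne
    have h1 := (hp j).1.snd_ne (hp j).2
    rcases hdis j j' hne (p j).snd ((p j).getVert_mem_support _)
      (by simp only at h; rw [h]; exact ((p j').getVert_mem_support _)) with h2 | h2
    exacts [h1.1 h2, h1.2 h2]

/-- All second vertices, together with the penultimate vertices of the longer paths, are distinct
and lie outside `{u, v}`. -/
theorem two_mul_le_card_length_two {u v : V} (huv : u ≠ v) {I : Fin (k - 1) → ι}
    {p : ∀ j, (G (I j)).Walk u v} (hp : ∀ j, (p j).IsPath ∧ 2 ≤ (p j).length)
    (hdis : ∀ j j', j ≠ j' → ∀ x, x ∈ (p j).support → x ∈ (p j').support → x = u ∨ x = v) :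
    2 * (k - 1) + 2 ≤ Fintype.card V + #{j | (p j).length = 2} := by
  have hdis' : ∀ j j' x, x ∈ (p j).support → x ∈ (p j').support → x ≠ u → x ≠ v → j = j' := by
    intro j j' x h1 h2 h3 h4
    by_contra hne
    rcases hdis j j' hne x h1 h2 with h | h
    exacts [h3 h, h4 h]
  have hs := fun j => (hp j).1.snd_ne (hp j).2
  have hpen := fun j => (hp j).1.penultimate_ne (hp j).2
  have c1 : #(univ.image fun j => (p j).snd) = k - 1 := by
    rw [card_image_of_injective, card_univ, Fintype.card_fin]
    intro j j' h
    exact hdis' j j' (p j).snd ((p j).getVert_mem_support _)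
      (by simp only at h; rw [h]; exact ((p j').getVert_mem_support _)) (hs j).1 (hs j).2
  have c2 : #(image (fun j => (p j).penultimate) {j | ¬ (p j).length = 2}) =
      #{j | ¬ (p j).length = 2} := by
    rw [card_image_of_injective]
    intro j j' h
    exact hdis' j j' (p j).penultimate ((p j).getVert_mem_support _)
      (by simp only at h; rw [h]; exact ((p j').getVert_mem_support _)) (hpen j).1 (hpen j).2
  have c3 : Disjoint (univ.image fun j => (p j).snd)
      (image (fun j => (p j).penultimate) {j | ¬ (p j).length = 2}) := by
    rw [disjoint_left]
    intro x hx hx'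
    simp only [mem_image, mem_filter, mem_univ, true_and] at hx hx'
    obtain ⟨j, rfl⟩ := hx
    obtain ⟨j', hj', h⟩ := hx'
    obtain rfl := hdis' j j' (p j).snd ((p j).getVert_mem_support _)
      (by rw [← h]; exact ((p j').getVert_mem_support _)) (hs j).1 (hs j).2
    have := (hp j).1.getVert_injOn (x₁ := (p j).length - 1) (x₂ := 1) (by simp)
      (by have := (hp j).2; simp; omega) h
    have := (hp j).2
    omega
  have c4 : (univ.image fun j => (p j).snd) ∪
      (image (fun j => (p j).penultimate) {j | ¬ (p j).length = 2}) ⊆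
        (univ.erase u).erase v := by
    intro x hx
    simp only [mem_union, mem_image, mem_filter, mem_univ, true_and] at hx
    rcases hx with ⟨j, rfl⟩ | ⟨j, -, rfl⟩
    · simpa using (hs j).symm
    · simpa using (hpen j).symm
  have c5 := card_le_card c4
  rw [card_union_of_disjoint c3, c1, c2, card_erase_of_mem (by simpa using huv.symm),
    card_erase_of_mem (mem_univ u), card_univ] at c5
  have c6 := card_filter_add_card_filter_not (s := (univ : Finset (Fin (k - 1))))
    (fun j => (p j).length = 2)
  rw [card_univ, Fintype.card_fin] at c6
  have : 2 ≤ Fintype.card V := Fintype.one_lt_card_iff.2 ⟨u, v, huv⟩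
  omega

theorem two_le_maxDegree (hG : IsCover G k) (i : ι) : 2 ≤ (G i).maxDegree := by
  obtain ⟨u, hu⟩ := hG.two_le_degree i
  exact hu.trans ((G i).degree_le_maxDegree u)

theorem exists_adj (hG : IsCover G k) (hk : 2 ≤ k) (hn : 2 ≤ Fintype.card V) (u : V) :
    ∃ i v, (G i).Adj u v := by
  have : Nontrivial V := Fintype.one_lt_card_iff_nontrivial.1 hn
  obtain ⟨v, hv⟩ := exists_ne u
  obtain ⟨I, p, hp, -⟩ := hG.paths u v hv.symm
  exact ⟨I ⟨0, by omega⟩, _, (p ⟨0, by omega⟩).adj_snd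
    (SimpleGraph.Walk.not_nil_of_two_le (hp _).2)⟩

theorem le_sum_degree (hG : IsCover G k) (hk : 2 ≤ k) (hn : 2 ≤ Fintype.card V) (u : V) :
    k ≤ ∑ i, (G i).degree u := by
  obtain ⟨i, v, h⟩ := hG.exists_adj hk hn u
  exact (hG.le_sum_min h).trans (sum_le_sum fun i _ => min_le_left _ _)

/-- For some pair at most Δ − 1 paths have length two, where Δ is the largest degree, but
disjointness in n vertices forces at least 2k − n such paths. -/
theorem exists_large_maxDegree (hG : IsCover G k) (hk : 2 ≤ k) (hn : 2 ≤ Fintype.card V) :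
    ∃ i, 2 * k + 1 ≤ Fintype.card V + (G i).maxDegree := by
  have : Nonempty V := Fintype.card_pos_iff.1 (by omega)
  obtain ⟨i₀, -⟩ := hG.exists_adj hk hn (Classical.arbitrary V)
  obtain ⟨i, -, hi⟩ := exists_max_image univ (fun i => (G i).maxDegree) ⟨i₀, mem_univ _⟩
  have h2 := hG.two_le_maxDegree i
  obtain ⟨v, hv, hm⟩ := hG.card_middles_le hn (Classical.arbitrary V)
    (fun j => hi j (mem_univ j)) (by omega)
  obtain ⟨I, p, hp, hdis⟩ := hG.paths _ v hv.symm
  have h3 := card_length_two_le hp hdis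
  have h4 := two_mul_le_card_length_two hv.symm hp hdis
  exact ⟨i, by omega⟩

/-- The degree-sum bound valid for all `k`. -/
theorem general_bound (hG : IsCover G k) (hk : 2 ≤ k) (hn : k < Fintype.card V) :
    k * Fintype.card V + 2 * Fintype.card ι + k + 1 ≤
      ∑ i, ∑ v, (G i).degree v + Fintype.card V + 2 := by
  have : Nonempty V := Fintype.card_pos_iff.1 (by omega)
  obtain ⟨i, hi⟩ := hG.exists_large_maxDegree hk (by omega)
  have h1 := hG.sum_degree_ge hk
  have h2 : 2 * Fintype.card ι + (G i).maxDegree ≤ ∑ i, (G i).maxDegree + 2 := by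
    rw [← add_sum_erase _ _ (mem_univ i)]
    have : ∑ i ∈ univ.erase i, 2 ≤ ∑ i ∈ univ.erase i, (G i).maxDegree :=
      sum_le_sum fun j _ => hG.two_le_maxDegree j
    rw [sum_const, card_erase_of_mem (mem_univ i), card_univ, smul_eq_mul] at this
    have : 0 < Fintype.card ι := Fintype.card_pos_iff.2 ⟨i⟩
    omega
  obtain ⟨m, hm⟩ : ∃ m, Fintype.card V = m + 1 := ⟨Fintype.card V - 1, by omega⟩
  rw [hm, Nat.add_sub_cancel] at h1
  rw [hm] at hi ⊢
  nlinarith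

/-- In a spanning `2`-regular class there is at most one path of a system of at least three
indirect paths. -/
theorem card_two_regular_le (hG : IsCover G k) (hk : 4 ≤ k) {u v : V}
    {I : Fin (k - 1) → ι}
    {p : ∀ j, (G (I j)).Walk u v} (hp : ∀ j, (p j).IsPath ∧ 2 ≤ (p j).length)
    (hdis : ∀ j j', j ≠ j' → ∀ x, x ∈ (p j).support → x ∈ (p j').support → x = u ∨ x = v)
    {i : ι} (hi : ∀ a, (G i).degree a = 2) : #{j | I j = i} ≤ 1 := by
  rw [card_le_one]
  intro a ha b hb
  by_contra hab
  simp only [mem_filter, mem_univ, true_and] at ha hb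
  subst ha
  have hadj : ∀ x, ∃ y, (G (I a)).Adj x y := fun x =>
    (SimpleGraph.degree_pos_iff_exists_adj _ _).1 (by rw [hi]; omega)
  have hcov := mem_support_of_two_regular (congrArg G hb) (fun x y => by
    obtain ⟨x', hx⟩ := hadj x
    obtain ⟨y', hy⟩ := hadj y
    exact hG.reachable (I a) x y x' y' hx hy) hi (hp a) (hp b) (hdis a b hab)
  obtain ⟨c, hc⟩ : ∃ c, c ∉ ({a, b} : Finset (Fin (k - 1))) := by
    by_contra! h
    have := card_le_card (fun c _ => h c : (univ : Finset (Fin (k - 1))) ⊆ {a, b})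
    have := card_le_two (a := a) (b := b)
    simp at *
    omega
  simp only [mem_insert, mem_singleton, not_or] at hc
  have hs := (hp c).1.snd_ne (hp c).2
  rcases hcov (p c).snd with h | h
  · rcases hdis c a hc.1 _ ((p c).getVert_mem_support _) h with h | h
    exacts [hs.1 h, hs.2 h]
  · rcases hdis c b hc.2 _ ((p c).getVert_mem_support _) h with h | h
    exacts [hs.1 h, hs.2 h]

theorem three_le_card_level (hG : IsCover G k) (i : ι) : 3 ≤ #(level G i 0) := by
  obtain ⟨u, hu⟩ := hG.two_le_degree i
  have : insert u ((G i).neighborFinset u) ⊆ level G i 0 := by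
    intro x hx
    rw [mem_level]
    rcases mem_insert.1 hx with rfl | hx
    · omega
    · rw [SimpleGraph.degree_pos_iff_exists_adj]
      exact ⟨u, by simpa [SimpleGraph.adj_comm] using hx⟩
  have h := card_le_card this
  rw [card_insert_of_notMem (by simp), SimpleGraph.card_neighborFinset_eq_degree] at h
  omega

theorem sum_degree_eq_sum_level (G : ι → SimpleGraph V) (i : ι) :
    ∑ v, (G i).degree v = ∑ l ∈ range (G i).maxDegree, #(level G i l) := by
  have h : ∀ v, (G i).degree v = ∑ l ∈ range (G i).maxDegree,
      if l < (G i).degree v then 1 else 0 := by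
    intro v
    rw [← card_filter]
    conv_lhs => rw [← card_range ((G i).degree v)]
    congr 1
    ext l
    have := (G i).degree_le_maxDegree v
    simp only [mem_range, mem_filter]
    omega
  simp_rw [level, card_filter]
  rw [sum_comm]
  exact sum_congr rfl fun v _ => h v

theorem le_sum_degree_of_level_eq_univ (hG : IsCover G k) {i : ι} (hi : level G i 0 = univ) :
    2 * Fintype.card V ≤ ∑ v, (G i).degree v + 2 := by
  obtain ⟨u, -⟩ := hG.two_le_degree i
  have hadj : ∀ x, ∃ y, (G i).Adj x y := fun x =>
    (SimpleGraph.degree_pos_iff_exists_adj _ _).1 (mem_level.1 (hi ▸ mem_univ x))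
  have hc : (G i).Connected :=
    { preconnected := fun x y => by
        obtain ⟨x', hx⟩ := hadj x
        obtain ⟨y', hy⟩ := hadj y
        exact hG.reachable i x y x' y' hx hy
      nonempty := ⟨u⟩ }
  have h := hc.card_vert_le_card_edgeSet_add_one
  rw [SimpleGraph.sum_degrees_eq_twice_card_edges]
  rw [Nat.card_eq_fintype_card, Nat.card_eq_fintype_card, ← SimpleGraph.edgeFinset_card] at h
  omega

end IsCover

end

/-! ### The bound for `k` at most five -/

section

variable {V ι : Type*} [Fintype V] [Fintype ι]

namespace IsCover

variable {G : ι → SimpleGraph V} {k : ℕ}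

theorem sum_maxDegree (hG : IsCover G k) :
    ∑ i, (G i).maxDegree = 2 * Fintype.card ι + ∑ i, ((G i).maxDegree - 2) := by
  have h : ∀ i, (G i).maxDegree = 2 + ((G i).maxDegree - 2) := fun i => by
    have := hG.two_le_maxDegree i; omega
  rw [sum_congr rfl fun i _ => h i, sum_add_distrib, sum_const, card_univ, smul_eq_mul, mul_comm]

/-- The excess of the maximum degrees over two is small if there are few edges. -/
theorem excess_le (hG : IsCover G k) (hk : 2 ≤ k) (hn : k < Fintype.card V)
    (hcon : ∑ i, ∑ v, (G i).degree v + 3 ≤ k * Fintype.card V + 2 * Fintype.card ι) :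
    ∑ i, ((G i).maxDegree - 2) + 3 ≤ k := by
  have : Nonempty V := Fintype.card_pos_iff.1 (by omega)
  have h1 := hG.sum_degree_ge hk
  rw [hG.sum_maxDegree] at h1
  obtain ⟨m, hm⟩ : ∃ m, Fintype.card V = m + 1 := ⟨Fintype.card V - 1, by omega⟩
  rw [hm, Nat.add_sub_cancel] at h1
  rw [hm] at hcon
  nlinarith

/-- A larger proper level set would supply `k - 2 - Q` leaves, `Q` being the excess, and lift the
degree sum to kn + 2p − 2. -/
theorem card_level_le (hG : IsCover G k) (hk : 2 ≤ k) (hn : k < Fintype.card V)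
    (hcon : ∑ i, ∑ v, (G i).degree v + 3 ≤ k * Fintype.card V + 2 * Fintype.card ι)
    {i : ι} {l : ℕ} (hX : level G i l ≠ univ) :
    #(level G i l) + ∑ i, ((G i).maxDegree - 2) + 2 ≤ k := by
  have hQ := hG.excess_le hk hn hcon
  set Q := ∑ i, ((G i).maxDegree - 2)
  by_contra! hlt
  have h1 := hG.sum_degree_ge_of_level hX (j := k - 2 - Q) (by omega) (by omega)
  rw [hG.sum_maxDegree] at h1
  obtain ⟨m, hm⟩ : ∃ m, Fintype.card V = m + 1 := ⟨Fintype.card V - 1, by omega⟩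
  rw [hm, Nat.add_sub_cancel] at h1
  rw [hm] at hcon
  have h2 : m * k + k = k * (m + 1) := by ring
  omega

/-- Connectedness forces degree sum at least 2n − 2, so at least n − 2 vertices have degree two.
That is too many for a proper level set. -/
theorem degree_eq_two (hG : IsCover G k) (hk : 2 ≤ k) (hn : k < Fintype.card V)
    (hcon : ∑ i, ∑ v, (G i).degree v + 3 ≤ k * Fintype.card V + 2 * Fintype.card ι)
    {i : ι} (hi : (G i).maxDegree = 2) (hX : level G i 0 = univ) (v : V) :
    (G i).degree v = 2 := by
  have h1 := hG.le_sum_degree_of_level_eq_univ hX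
  have h2 := sum_degree_eq_sum_level G i
  rw [hi] at h2
  simp only [sum_range_succ, range_zero, sum_empty, zero_add, hX, card_univ] at h2
  have h3 : level G i 1 = univ := by
    by_contra h
    have := hG.card_level_le hk hn hcon h
    omega
  have h4 := mem_level.1 (h3 ▸ mem_univ v)
  have := (G i).degree_le_maxDegree v
  omega

/-- If all graphs of the family are spanning, those of maximum degree two are `2`-regular, and
there are at most two others. -/
theorem false_of_spanning (hG : IsCover G k) (hk : 4 ≤ k) (hk5 : k ≤ 5) (hn : k < Fintype.card V)
    (hcon : ∑ i, ∑ v, (G i).degree v + 3 ≤ k * Fintype.card V + 2 * Fintype.card ι)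
    (hX : ∀ i, level G i 0 = univ) : False := by
  have hQ := hG.excess_le (by omega) hn hcon
  have hlev := fun i l => hG.card_level_le (by omega) hn hcon (i := i) (l := l)
  set Q := ∑ i, ((G i).maxDegree - 2) with hQdef
  have hreg := fun i hi => hG.degree_eq_two (by omega) hn hcon (i := i) hi (hX i)
  have hone := fun i (hi : (G i).maxDegree = 2) u v I p hp hdis =>
    hG.card_two_regular_le hk (u := u) (v := v) (I := I) (p := p) hp hdis (hreg i hi)
  let A : Finset ι := {i | (G i).maxDegree = 2}
  let B : Finset ι := {i | ¬ (G i).maxDegree = 2}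
  have hAB : #A + #B = Fintype.card ι := by
    simpa using card_filter_add_card_filter_not (s := (univ : Finset ι))
      (fun i => (G i).maxDegree = 2)
  have hBQ : #B ≤ Q := by
    rw [card_filter]
    refine sum_le_sum fun i _ => ?_
    have := hG.two_le_maxDegree i
    split_ifs <;> omega
  have : Nontrivial V := Fintype.one_lt_card_iff_nontrivial.1 (by omega)
  have hswap : ∑ i, ∑ v, (G i).degree v = ∑ v, ∑ i, (G i).degree v := sum_comm
  set n := Fintype.card V
  rcases B.eq_empty_or_nonempty with hB | ⟨i₁, hi₁⟩
  -- Only 2-regular classes, each carrying at most one of the `k - 1` paths: then p ≥ k − 1 and the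
  -- degree sum 2np is too large.
  · have hall : ∀ i, (G i).maxDegree = 2 := fun i => by
      by_contra h
      have : i ∈ B := by simpa [B] using h
      simp [hB] at this
    obtain ⟨u, v, huv⟩ := exists_pair_ne V
    obtain ⟨I, p, hp, hdis, -⟩ := hG.exists_count huv
    have h1 := sum_le_sum fun i (_ : i ∈ univ) => hone i (hall i) u v I p hp hdis
    rw [sum_card_fiber, sum_const, card_univ, smul_eq_mul, mul_one] at h1
    have h2 : ∑ i, ∑ v, (G i).degree v = Fintype.card ι * (n * 2) := by
      rw [sum_congr rfl fun i _ => sum_congr rfl fun v _ => hreg i (hall i) v]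
      simp [n]
    rw [h2] at hcon
    obtain ⟨a, rfl⟩ : ∃ a, k = a + 2 := ⟨k - 2, by omega⟩
    obtain ⟨b, hb⟩ : ∃ b, n = b + 2 := ⟨n - 2, by omega⟩
    obtain ⟨c, hc⟩ : ∃ c, Fintype.card ι = a + 1 + c := ⟨Fintype.card ι - (a + 1), by omega⟩
    rw [hb, hc] at hcon
    nlinarith [Nat.zero_le (a * b), Nat.zero_le (b * c)]
  have hi₁' : ¬ (G i₁).maxDegree = 2 := by simpa [B] using hi₁
  -- At an edge `uv` of `i₁`, the degrees at `u` account for the `k - 1` paths and this edge; each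
  -- 2-regular class has degree two but at most one path, hence one to spare.
  have hdeg : ∀ u, k + #A ≤ ∑ i, (G i).degree u := by
    intro u
    obtain ⟨v, hv⟩ := (SimpleGraph.degree_pos_iff_exists_adj _ _).1
      (mem_level.1 ((hX i₁) ▸ mem_univ u))
    obtain ⟨I, p, hp, hdis, hc⟩ := hG.exists_count hv.ne
    have h1 : ∀ i, #{j | I j = i} + (if i = i₁ then 1 else 0) +
        (if (G i).maxDegree = 2 then 1 else 0) ≤ (G i).degree u := by
      intro i
      have h1 := (hc i).trans (min_le_left _ _)
      split_ifs with h2 h3 h3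
      · exact absurd (h2 ▸ h3) hi₁'
      · rw [h2, if_pos hv] at h1; rw [h2]; exact h1
      · have := hone i h3 u v I p hp hdis
        rw [hreg i h3]; omega
      · omega
    have h2 := sum_le_sum fun i (_ : i ∈ univ) => h1 i
    rw [sum_add_distrib, sum_add_distrib, sum_card_fiber, sum_ite_eq' univ i₁, ← card_filter] at h2
    simp only [mem_univ, if_true] at h2
    change k - 1 + 1 + #A ≤ _ at h2
    omega
  have hsum : n * (k + #A) ≤ ∑ v, ∑ i, (G i).degree v := by
    have := sum_le_sum fun u (_ : u ∈ univ) => hdeg u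
    rwa [sum_const, card_univ, smul_eq_mul] at this
  rw [hswap] at hcon
  have hB1 : 0 < #B := card_pos.2 ⟨i₁, hi₁⟩
  rcases Nat.eq_zero_or_pos #A with hA | hA
  -- Now p ≤ `Q` ≤ k − 3, so only `k = 5` with two classes of maximum degree three is left. Both
  -- turn out to be cubic.
  · rw [hA] at hsum
    have hkn : n * (k + 0) = k * n := by ring
    have hp2 : Fintype.card ι = 2 := by omega
    have hQ2 : Q = 2 := by omega
    have hk' : k = 5 := by omega
    have hall : ∀ i, (G i).maxDegree = 3 := by
      have hge : ∀ i, 3 ≤ (G i).maxDegree := fun i => by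
        have hiA : i ∉ A := by rw [card_eq_zero.1 hA]; simp
        have : ¬ (G i).maxDegree = 2 := by simpa [A] using hiA
        have := hG.two_le_maxDegree i
        omega
      intro i
      by_contra hne
      have : ∑ i : ι, 1 < ∑ i, ((G i).maxDegree - 2) :=
        sum_lt_sum (fun j _ => by have := hge j; omega)
          ⟨i, mem_univ i, by have := hge i; omega⟩
      simp only [sum_const, card_univ, smul_eq_mul, mul_one] at this
      omega
    have h3 : ∀ i, ∑ v, (G i).degree v = 3 * n := by
      intro i
      have h1 := hG.le_sum_degree_of_level_eq_univ (hX i)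
      have h2 := sum_degree_eq_sum_level G i
      rw [hall i] at h2
      simp only [sum_range_succ, range_zero, sum_empty, zero_add, hX, card_univ] at h2
      have h4 : #(level G i 2) ≤ #(level G i 1) :=
        card_le_card fun x hx => mem_level.2 (by have := mem_level.1 hx; omega)
      have h5 : #(level G i 1) = n := by
        by_cases h : level G i 1 = univ
        · rw [h, card_univ]
        · have := hlev i 1 h
          omega
      have h6 : #(level G i 2) = n := by
        by_cases h : level G i 2 = univ
        · rw [h, card_univ]
        -- A proper level set has at most one vertex here, and exactly one would make the degree sum
        -- 2n + 1 odd.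
        · have h7 := hlev i 2 h
          have h8 : 0 < #(level G i 2) := by
            obtain ⟨w, hw⟩ := (G i).exists_maximal_degree_vertex
            exact card_pos.2 ⟨w, mem_level.2 (by rw [← hw, hall i]; omega)⟩
          have h9 := (G i).sum_degrees_eq_twice_card_edges
          omega
      omega
    rw [← hswap, sum_congr rfl fun i _ => h3 i, sum_const, card_univ, smul_eq_mul, hp2, hk'] at hcon
    omega
  · have h2 : n * (k + #A) = k * n + n * #A := by ring
    have h3 : 5 * #A ≤ n * #A := Nat.mul_le_mul_right _ (by omega)
    omega

/-- If all graphs of the family are `2`-regular and spanning or have three non-isolated vertices,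
then there are too many edges. -/
theorem false_of_level_le_three (hG : IsCover G 5) (hn : 5 < Fintype.card V)
    (hcon : ∑ i, ∑ v, (G i).degree v + 3 ≤ 5 * Fintype.card V + 2 * Fintype.card ι)
    (hD : ∀ i, (G i).maxDegree = 2) (hX : ∀ i, level G i 0 ≠ univ → #(level G i 0) ≤ 3) :
    False := by
  have hreg := fun i hi => hG.degree_eq_two (by omega) hn hcon (i := i) (hD i) hi
  let A : Finset ι := {i | level G i 0 = univ}
  rcases Nat.lt_or_ge #A 3 with hA | hA
  -- Some pair has at most one path of length two. The other paths of its system of four lie in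
  -- spanning classes, at most one in each, so two such classes do not suffice.
  · have : Nonempty V := Fintype.card_pos_iff.1 (by omega)
    obtain ⟨v, hv, hm⟩ := hG.card_middles_le (by omega) (Classical.arbitrary V) (D := 2)
      (fun i => (hD i).le) (by omega)
    obtain ⟨I, p, hp, hdis⟩ := hG.paths _ v hv.symm
    have h1 := card_length_two_le hp hdis
    have h2 : #{j | I j ∈ A} ≤ #A := by
      rw [card_eq_sum_card_fiberwise (f := I) (t := A) (fun j hj => by simpa using hj),
        card_eq_sum_ones]
      refine sum_le_sum fun i hi => ?_
      refine le_trans (card_le_card ?_) (hG.card_two_regular_le (by omega) hp hdis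
        (hreg i (by simpa [A] using hi)))
      intro j hj
      simp only [mem_filter, mem_univ, true_and] at hj ⊢
      exact hj.2
    have h3 : #{j | ¬ I j ∈ A} ≤ #{j | (p j).length = 2} := by
      refine card_le_card fun j hj => ?_
      simp only [mem_filter, mem_univ, true_and, A] at hj ⊢
      have h4 : (p j).support.toFinset ⊆ level G (I j) 0 := by
        intro x hx
        rw [List.mem_toFinset] at hx
        rw [mem_level, SimpleGraph.degree_pos_iff_exists_adj]
        have hnn := SimpleGraph.Walk.not_nil_of_two_le (hp j).2
        obtain ⟨e, he, hxe⟩ := (SimpleGraph.Walk.mem_support_iff_exists_mem_edges_of_not_nil hnn).1 hx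
        induction e with | _ a b =>
        have hab := (p j).adj_of_mem_edges he
        rcases Sym2.mem_iff.1 hxe with rfl | rfl
        exacts [⟨_, hab⟩, ⟨_, hab.symm⟩]
      have h5 := card_le_card h4
      rw [List.toFinset_card_of_nodup (hp j).1.support_nodup,
        SimpleGraph.Walk.length_support] at h5
      have h6 := hX _ hj
      have := (hp j).2
      omega
    have h4 := card_filter_add_card_filter_not (s := (univ : Finset (Fin (5 - 1))))
      (fun j => I j ∈ A)
    rw [card_univ, Fintype.card_fin] at h4
    omega
  -- Every class has degree sum at least four, and a spanning one has 2n.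
  · have h1 : ∑ i, (4 + if i ∈ A then 2 * Fintype.card V - 4 else 0) ≤
        ∑ i, ∑ v, (G i).degree v := by
      refine sum_le_sum fun i _ => ?_
      split_ifs with hi
      · rw [sum_congr rfl fun v _ => hreg i (by simpa [A] using hi) v, sum_const, card_univ,
          smul_eq_mul]
        omega
      · rw [sum_degree_eq_sum_level, hD i]
        simp only [sum_range_succ, range_zero, sum_empty, zero_add]
        have h2 := hG.three_le_card_level i
        have h3 : 0 < #(level G i 1) := by
          obtain ⟨u, hu⟩ := hG.two_le_degree i
          exact card_pos.2 ⟨u, mem_level.2 hu⟩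
        omega
    rw [sum_add_distrib, sum_const, card_univ, smul_eq_mul, ← sum_filter, sum_const,
      smul_eq_mul, filter_mem_eq_inter, univ_inter] at h1
    have h2 : 3 * (2 * Fintype.card V - 4) ≤ #A * (2 * Fintype.card V - 4) :=
      Nat.mul_le_mul_right _ hA
    have hp : #A ≤ Fintype.card ι := card_le_univ A
    omega

/-- The degree-sum bound for small `k`. -/
theorem small_bound (hG : IsCover G k) (hk : 2 ≤ k) (hk5 : k ≤ 5) (hn : k < Fintype.card V) :
    k * Fintype.card V + 2 * Fintype.card ι ≤ ∑ i, ∑ v, (G i).degree v + 2 := by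
  by_contra! hlt
  have hcon : ∑ i, ∑ v, (G i).degree v + 3 ≤ k * Fintype.card V + 2 * Fintype.card ι := hlt
  have hQ := hG.excess_le hk hn hcon
  have hlev := fun i => hG.card_level_le hk hn hcon (i := i) (l := 0)
  have h3 := hG.three_le_card_level
  have hD : ∑ i, ((G i).maxDegree - 2) = 0 → ∀ i, (G i).maxDegree = 2 := by
    intro h i
    have := sum_eq_zero_iff.1 h i (mem_univ i)
    have := hG.two_le_maxDegree i
    omega
  -- The non-isolated vertices of a class that does not span number at least 3 and at most `k - 2`
  -- minus the excess, which forces this case.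
  by_cases h50 : k = 5 ∧ ∑ i, ((G i).maxDegree - 2) = 0
  · obtain ⟨rfl, h0⟩ := h50
    exact hG.false_of_level_le_three hn hcon (hD h0) fun i hi => by have := hlev i hi; omega
  have hX : ∀ i, level G i 0 = univ := by
    intro i
    by_contra h
    have := hlev i h
    have := h3 i
    omega
  rcases Nat.lt_or_ge k 4 with hk4 | hk4
  -- `k = 2` contradicts `hQ`. For `k = 3` every vertex has total degree at least three, so there
  -- are at least two spanning 2-regular classes.
  · have hk3 : k = 3 := by omega
    subst hk3
    have hreg := fun i => hG.degree_eq_two hk hn hcon (hD (by omega) i) (hX i)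
    have hne : Nonempty V := Fintype.card_pos_iff.1 (by omega)
    have h4 := hG.le_sum_degree hk (by omega) (Classical.arbitrary V)
    rw [sum_congr rfl fun i _ => hreg i _, sum_const, card_univ, smul_eq_mul] at h4
    rw [sum_congr rfl fun i _ => sum_congr rfl fun v _ => hreg i v] at hcon
    simp only [sum_const, card_univ, smul_eq_mul] at hcon
    obtain ⟨a, ha⟩ : ∃ a, Fintype.card ι = a + 2 := ⟨Fintype.card ι - 2, by omega⟩
    obtain ⟨b, hb⟩ : ∃ b, Fintype.card V = b + 4 := ⟨Fintype.card V - 4, by omega⟩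
    rw [ha, hb] at hcon
    nlinarith [Nat.zero_le (a * b)]
  · exact hG.false_of_spanning hk4 hk5 hn hcon hX

end IsCover

end

/-! ### From colourings to covers -/

section

variable {V K : Type*} [Fintype V]

/-- The component of `v` in the graph of the edges of colour `c`, as a graph on all vertices. -/
def colourComponent (φ : (⊤ : SimpleGraph V).EdgeLabeling K) (c : K) (v : V) : SimpleGraph V where
  Adj a b := (φ.labelGraph c).Adj a b ∧ (φ.labelGraph c).Reachable v a
  symm := ⟨fun _ _ h => ⟨h.1.symm, h.2.trans h.1.reachable⟩⟩
  loopless := ⟨fun _ h => h.1.ne rfl⟩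

theorem colourComponent_eq {φ : (⊤ : SimpleGraph V).EdgeLabeling K} {c c' : K} {v v' a b : V}
    (h : (colourComponent φ c v).Adj a b) (h' : (colourComponent φ c' v').Adj a b) :
    colourComponent φ c v = colourComponent φ c' v' := by
  obtain ⟨h1, h2⟩ := h
  obtain ⟨h3, h4⟩ := h'
  rw [SimpleGraph.EdgeLabeling.labelGraph_adj] at h1 h3
  obtain ⟨hab, rfl⟩ := h1
  obtain ⟨_, rfl⟩ := h3
  have h5 := h2.trans h4.symm
  ext x y
  exact and_congr_right fun _ => ⟨h5.symm.trans, h5.trans⟩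

theorem colourComponent_reachable {φ : (⊤ : SimpleGraph V).EdgeLabeling K} {c : K} {v u : V}
    (h : (φ.labelGraph c).Reachable v u) : (colourComponent φ c v).Reachable v u := by
  obtain ⟨p⟩ := h
  refine ⟨p.transfer _ fun e he => ?_⟩
  induction e with | _ a b =>
  exact ⟨p.adj_of_mem_edges he, ⟨p.takeUntil a (p.fst_mem_support_of_mem_edges he)⟩⟩

/-- The components with at least two edges of the colour classes. -/
abbrev Component (φ : (⊤ : SimpleGraph V).EdgeLabeling K) : Type _ :=
  {H : SimpleGraph V // (∃ c v, H = colourComponent φ c v) ∧ ∃ u, 2 ≤ H.degree u}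

noncomputable instance (φ : (⊤ : SimpleGraph V).EdgeLabeling K) : Fintype (Component φ) :=
  Fintype.ofFinite _

theorem exists_indirect_paths {φ : (⊤ : SimpleGraph V).EdgeLabeling K} {k : ℕ}
    (hφ : φ.IsMonochromaticConnected k) {u v : V} (huv : u ≠ v) :
    ∃ P : Fin (k - 1) → (⊤ : SimpleGraph V).Walk u v,
      (∀ j, (P j).IsPath ∧ 2 ≤ (P j).length ∧ (P j).IsMonochromatic φ) ∧
      ∀ i j, i ≠ j → (P i).InternallyDisjoint (P j) := by
  obtain ⟨P, hinj, hdis, hmono⟩ := hφ u v huv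
  let S : Finset (Fin k) := {j | 2 ≤ (P j : (⊤ : SimpleGraph V).Walk u v).length}
  have hlen : ∀ j, 1 ≤ (P j : (⊤ : SimpleGraph V).Walk u v).length := fun j => by
    rw [Nat.one_le_iff_ne_zero]
    exact fun h => huv (SimpleGraph.Walk.eq_of_length_eq_zero h)
  have hS : k - 1 ≤ #S := by
    have h1 := card_filter_add_card_filter_not (s := (univ : Finset (Fin k)))
      (fun j => 2 ≤ (P j : (⊤ : SimpleGraph V).Walk u v).length)
    -- A path of length one is the edge `uv`, so injectivity allows only one.
    have h2 : #{j | ¬ 2 ≤ (P j : (⊤ : SimpleGraph V).Walk u v).length} ≤ 1 := by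
      rw [card_le_one]
      intro a ha b hb
      simp only [mem_filter, mem_univ, true_and, not_le] at ha hb
      apply hinj
      apply Subtype.ext
      have ha1 : (P a : (⊤ : SimpleGraph V).Walk u v).length = 1 := by have := hlen a; omega
      have hb1 : (P b : (⊤ : SimpleGraph V).Walk u v).length = 1 := by have := hlen b; omega
      generalize (P a : (⊤ : SimpleGraph V).Walk u v) = p at *
      generalize (P b : (⊤ : SimpleGraph V).Walk u v) = q at *
      cases p with
      | nil => simp at ha1
      | cons h p' =>
        cases q with
        | nil => simp at hb1
        | cons h' q' =>
          simp only [SimpleGraph.Walk.length_cons, Nat.add_eq_right] at ha1 hb1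
          have hp := SimpleGraph.Walk.eq_of_length_eq_zero ha1
          have hq := SimpleGraph.Walk.eq_of_length_eq_zero hb1
          subst hp
          subst hq
          rw [SimpleGraph.Walk.length_eq_zero_iff, ← SimpleGraph.Walk.eq_nil_iff_nil] at ha1 hb1
          rw [ha1, hb1]
    rw [card_univ, Fintype.card_fin] at h1
    change #S + _ = _ at h1
    omega
  obtain ⟨S', hS', hcard⟩ := exists_subset_card_eq hS
  let e := S'.orderEmbOfFin hcard
  refine ⟨fun j => P (e j), fun j => ⟨(P (e j)).2, ?_, hmono _⟩, fun i j hij => hdis _ _ ?_⟩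
  · exact (mem_filter.1 (hS' (S'.orderEmbOfFin_mem hcard j))).2
  · exact fun h => hij (e.injective h)

/-- A monochromatic path from `u` stays in the component of `u` in its colour, and an indirect path
has two edges at its second vertex, so this component belongs to the family. -/
theorem isCover_component {φ : (⊤ : SimpleGraph V).EdgeLabeling K} {k : ℕ}
    (hφ : φ.IsMonochromaticConnected k) : IsCover (fun H : Component φ => H.1) k where
  disjoint := by
    rintro ⟨H, ⟨c, w, rfl⟩, h⟩ ⟨H', ⟨c', w', rfl⟩, h'⟩ u v h1 h2
    exact Subtype.ext (colourComponent_eq h1 h2)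
  reachable := by
    rintro ⟨H, ⟨c, w, rfl⟩, h⟩ u v u' v' h1 h2
    exact (colourComponent_reachable h1.2).symm.trans (colourComponent_reachable h2.2)
  two_le_degree := fun H => H.2.2
  paths := by
    intro u v huv
    obtain ⟨P, hP, hdis⟩ := exists_indirect_paths hφ huv
    have key : ∀ j, ∃ (H : Component φ) (p : H.1.Walk u v),
        (p.IsPath ∧ 2 ≤ p.length) ∧ p.support = (P j).support := by
      intro j
      obtain ⟨hpath, hlen, c, hc⟩ := hP j
      have hlab : ∀ a b, s(a, b) ∈ (P j).edges → (φ.labelGraph c).Adj a b := fun a b hab =>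
        (SimpleGraph.EdgeLabeling.labelGraph_adj _ _).2 ⟨(P j).adj_of_mem_edges hab, hc _ hab⟩
      have hreach : ∀ a ∈ (P j).support, (φ.labelGraph c).Reachable u a := fun a ha =>
        ⟨((P j).takeUntil a ha).transfer _ fun e he => by
          induction e with | _ x y =>
          exact hlab x y ((P j).edges_takeUntil_subset_edges ha he)⟩
      have hedge : ∀ e ∈ (P j).edges, e ∈ (colourComponent φ c u).edgeSet := by
        intro e he
        induction e with | _ x y =>
        exact ⟨hlab x y he, hreach x ((P j).fst_mem_support_of_mem_edges he)⟩
      let p := (P j).transfer (colourComponent φ c u) hedge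
      have hp : p.IsPath := hpath.transfer hedge
      have hpl : 2 ≤ p.length := by simpa [p] using hlen
      refine ⟨⟨colourComponent φ c u, ⟨c, u, rfl⟩, p.snd, ?_⟩, p, ⟨hp, hpl⟩, by simp [p]⟩
      have h1 := p.adj_getVert_succ (i := 0) (by omega)
      have h2 := p.adj_getVert_succ (i := 1) (by omega)
      have hne : p.getVert 0 ≠ p.getVert 2 := fun h => by
        have := hp.getVert_injOn (x₁ := 0) (x₂ := 2) (by simp) (by simpa using hpl) h
        omega
      rw [← card_pair hne, ← SimpleGraph.card_neighborFinset_eq_degree]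
      refine card_le_card fun x hx => ?_
      rcases mem_insert.1 hx with rfl | hx
      · simpa using h1.symm
      · rw [mem_singleton] at hx; subst hx; simpa using h2
    choose I p hp hsupp using key
    refine ⟨I, p, hp, fun j j' hjj x hx hx' => ?_⟩
    rw [hsupp] at hx hx'
    exact hdis j j' hjj x hx hx'

/-- One edge is set aside in each component and represents its colour. Hence every colour still
occurs after the remaining component edges `U` are deleted. -/
theorem card_add_sum_degree_le [Fintype K] {φ : (⊤ : SimpleGraph V).EdgeLabeling K}
    (hφ : Function.Surjective φ) :
    2 * Fintype.card K + ∑ H : Component φ, ∑ v, H.1.degree v ≤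
      2 * (Fintype.card V).choose 2 + 2 * Fintype.card (Component φ) := by
  have hne : ∀ H : Component φ, ∃ e, e ∈ H.1.edgeFinset := by
    intro H
    obtain ⟨u, hu⟩ := H.2.2
    obtain ⟨v, hv⟩ := (SimpleGraph.degree_pos_iff_exists_adj H.1 u).1 (by omega)
    exact ⟨s(u, v), by simpa using hv⟩
  choose rep hrep using hne
  let U : Finset (Sym2 V) := univ.biUnion fun H : Component φ => H.1.edgeFinset.erase (rep H)
  have hdisj : ∀ (H H' : Component φ) (e : Sym2 V), e ∈ H.1.edgeFinset → e ∈ H'.1.edgeFinset →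
      H = H' := by
    rintro ⟨H, ⟨c, w, rfl⟩, h⟩ ⟨H', ⟨c', w', rfl⟩, h'⟩ e h1 h2
    induction e with | _ a b =>
    rw [SimpleGraph.mem_edgeFinset] at h1 h2
    exact Subtype.ext (colourComponent_eq h1 h2)
  have hU : #U = ∑ H : Component φ, (#H.1.edgeFinset - 1) := by
    rw [card_biUnion]
    · exact sum_congr rfl fun H _ => card_erase_of_mem (hrep H)
    · intro H _ H' _ hHH
      refine disjoint_left.2 ?_
      intro e h1 h2
      exact hHH (hdisj H H' e (mem_of_mem_erase h1) (mem_of_mem_erase h2))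
  have hUE : U ⊆ (⊤ : SimpleGraph V).edgeFinset := by
    intro e he
    obtain ⟨H, -, h⟩ := mem_biUnion.1 he
    exact SimpleGraph.edgeFinset_mono le_top (mem_of_mem_erase h)
  have hK : Fintype.card K ≤ #((⊤ : SimpleGraph V).edgeFinset \ U) := by
    have hex : ∀ c : K, ∃ e : (⊤ : SimpleGraph V).edgeSet, φ e = c ∧ (e : Sym2 V) ∉ U := by
      intro c
      obtain ⟨e, he⟩ := hφ c
      by_cases heU : (e : Sym2 V) ∈ U
      · obtain ⟨H, -, hH⟩ := mem_biUnion.1 heU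
        have hr : rep H ∈ (⊤ : SimpleGraph V).edgeSet :=
          SimpleGraph.edgeSet_mono le_top (SimpleGraph.mem_edgeFinset.1 (hrep H))
        refine ⟨⟨rep H, hr⟩, ?_, fun h => ?_⟩
        · have hcol : ∀ (f : (⊤ : SimpleGraph V).edgeSet), (f : Sym2 V) ∈ H.1.edgeFinset →
              ∀ c', (∃ v, H.1 = colourComponent φ c' v) → φ f = c' := by
            rintro ⟨f, hf⟩ hfH c' ⟨v, hv⟩
            rw [SimpleGraph.mem_edgeFinset, hv] at hfH
            induction f with | _ a b =>
            exact ((SimpleGraph.EdgeLabeling.labelGraph_adj _ _).1 hfH.1).2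
          obtain ⟨c', v, hv⟩ := H.2.1
          rw [hcol ⟨rep H, hr⟩ (hrep H) c' ⟨v, hv⟩, ← he,
            hcol e (mem_of_mem_erase hH) c' ⟨v, hv⟩]
        · obtain ⟨H', -, hH'⟩ := mem_biUnion.1 h
          have := hdisj H H' _ (hrep H) (mem_of_mem_erase hH')
          subst this
          exact (mem_erase.1 hH').1 rfl
      · exact ⟨e, he, heU⟩
    choose f hf hfU using hex
    rw [← card_univ]
    refine card_le_card_of_injOn (fun c => (f c : Sym2 V)) ?_ ?_
    · intro c _
      simpa using ⟨by simpa using (f c).2, hfU c⟩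
    · intro c _ c' _ h
      rw [← hf c, ← hf c', Subtype.ext h]
  rw [card_sdiff_of_subset hUE, hU, SimpleGraph.card_edgeFinset_top_eq_card_choose_two] at hK
  have hle := card_le_card hUE
  rw [hU, SimpleGraph.card_edgeFinset_top_eq_card_choose_two] at hle
  simp_rw [SimpleGraph.sum_degrees_eq_twice_card_edges]
  rw [← mul_sum]
  have hsum : ∑ H : Component φ, #H.1.edgeFinset =
      ∑ H : Component φ, (#H.1.edgeFinset - 1) + Fintype.card (Component φ) := by
    rw [← card_univ, card_eq_sum_ones, ← sum_add_distrib]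
    refine sum_congr rfl fun H _ => ?_
    have := card_pos.2 ⟨_, hrep H⟩
    omega
  omega

/-- Upper bounds for the number of colours. -/
theorem colours_le {n k r : ℕ} (hk : 2 ≤ k) (hn : k < n)
    (hr : r ∈ SimpleGraph.monochromaticColourCounts (⊤ : SimpleGraph (Fin n)) k) :
    2 * r + k * n + k + 1 ≤ 2 * n.choose 2 + n + 2 ∧
      (k ≤ 5 → 2 * r + k * n ≤ 2 * n.choose 2 + 2) := by
  obtain ⟨φ, hφ, hmono⟩ := hr
  have hG := isCover_component hmono
  have h1 := card_add_sum_degree_le hφ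
  have h2 := hG.general_bound hk (by simpa using hn)
  have h3 := fun hk5 => hG.small_bound hk hk5 (by simpa using hn)
  simp only [Fintype.card_fin] at h1 h2 h3
  constructor
  · omega
  · intro hk5
    have := h3 hk5
    omega

end

/-! ### Disjoint paths in expanding graphs, by Hall's theorem -/

section

variable {V : Type*} [Fintype V]

/-- The vertices outside `S` with a neighbour in `S`. -/
noncomputable def outerBoundary (H : SimpleGraph V) (S : Finset V) : Finset V :=
  {y | y ∉ S ∧ ∃ x ∈ S, H.Adj x y}

theorem mem_outerBoundary {H : SimpleGraph V} {S : Finset V} {y : V} :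
    y ∈ outerBoundary H S ↔ y ∉ S ∧ ∃ x ∈ S, H.Adj x y := by
  simp [outerBoundary]

/-- Every nonempty vertex set that does not dominate the graph has at least `k` outer
neighbours. -/
def IsExpanding (H : SimpleGraph V) (k : ℕ) : Prop :=
  ∀ S : Finset V, S.Nonempty → (∃ y ∉ S, ∀ x ∈ S, ¬ H.Adj x y) → k ≤ #(outerBoundary H S)

/-- The successor relation in a system of `k` disjoint paths from `u` to `v`: the copies of `Fin k`
stand for `u` as a predecessor and for `v` as a successor. -/
def stepRel (H : SimpleGraph V) (u v : V) (k : ℕ) :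
    {x : V // x ≠ u ∧ x ≠ v} ⊕ Fin k → {x : V // x ≠ u ∧ x ≠ v} ⊕ Fin k → Prop
  | .inl x, .inl y => x = y ∨ H.Adj x y
  | .inl x, .inr _ => H.Adj x v
  | .inr _, .inl y => H.Adj u y
  -- Only copy 0 may use the edge `uv`, so that it serves for at most one path.
  | .inr i, .inr j => H.Adj u v ∧ i.val = 0 ∧ j.val = 0

/-- Hall's condition. A vertex may be its own successor, so vertices alone never violate it. Once a
copy of `u` is in `A`, either all copies of `v` are available or the outer boundary of `insert u S`
supplies `k` new successors, up to a correction for `v`. -/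
theorem exists_injective_stepRel {H : SimpleGraph V} {k : ℕ} (hH : IsExpanding H k)
    (hn : k < Fintype.card V) {u v : V} (huv : u ≠ v) :
    ∃ f : {x : V // x ≠ u ∧ x ≠ v} ⊕ Fin k → {x : V // x ≠ u ∧ x ≠ v} ⊕ Fin k,
      Function.Injective f ∧ ∀ z, stepRel H u v k z (f z) := by
  rw [← Fintype.all_card_le_filter_rel_iff_exists_injective]
  intro A
  let R : Finset ({x : V // x ≠ u ∧ x ≠ v} ⊕ Fin k) := {b | ∃ a ∈ A, stepRel H u v k a b}
  change #A ≤ #R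
  rw [← card_toLeft_add_card_toRight (u := A), ← card_toLeft_add_card_toRight (u := R)]
  have hself : A.toLeft ⊆ R.toLeft := fun x hx => by
    rw [mem_toLeft] at hx ⊢
    exact mem_filter.2 ⟨mem_univ _, _, hx, Or.inl rfl⟩
  rcases A.toRight.eq_empty_or_nonempty with hI | ⟨i₀, hi₀⟩
  · rw [hI, card_empty]
    exact (card_le_card hself).trans (Nat.le_add_right _ _)
  have hIk : #A.toRight ≤ k := (card_le_univ _).trans (by simp)
  by_cases hSv : ∃ x ∈ A.toLeft, H.Adj x v
  · obtain ⟨x, hx, hxv⟩ := hSv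
    have : R.toRight = univ := by
      rw [eq_univ_iff_forall]
      intro j
      rw [mem_toLeft] at hx
      exact mem_toRight.2 (mem_filter.2 ⟨mem_univ _, _, hx, hxv⟩)
    rw [this, card_univ, Fintype.card_fin]
    exact Nat.add_le_add (card_le_card hself) hIk
  push Not at hSv
  let S : Finset V := A.toLeft.map (Function.Embedding.subtype _)
  have hS : ∀ x, x ∈ S ↔ ∃ h, (⟨x, h⟩ : {x : V // x ≠ u ∧ x ≠ v}) ∈ A.toLeft := by
    intro x; simp [S]
  have huS : u ∉ S := fun h => ((hS u).1 h).1.1 rfl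
  have hvS : v ∉ S := fun h => ((hS v).1 h).1.2 rfl
  have hSv' : ∀ x ∈ S, ¬ H.Adj x v := fun x hx => by
    obtain ⟨h, h'⟩ := (hS x).1 hx
    exact hSv _ h'
  -- If `insert u S` dominates, its boundary is its complement. That is large enough because `insert
  -- v S`, of the same size, misses at least `k` neighbours of `v`.
  have hB : k ≤ #(outerBoundary H (insert u S)) := by
    by_cases hw : ∃ y ∉ insert u S, ∀ x ∈ insert u S, ¬ H.Adj x y
    · exact hH _ (insert_nonempty _ _) hw
    push Not at hw
    have hBeq : outerBoundary H (insert u S) = (insert u S)ᶜ := by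
      ext y
      simp only [outerBoundary, mem_filter, mem_univ, true_and, mem_compl]
      exact ⟨And.left, fun h => ⟨h, hw y h⟩⟩
    have hdeg : k ≤ #(outerBoundary H {v}) := by
      by_cases hw' : ∃ y ∉ ({v} : Finset V), ∀ x ∈ ({v} : Finset V), ¬ H.Adj x y
      · exact hH _ (singleton_nonempty _) hw'
      push Not at hw'
      have : outerBoundary H {v} = {v}ᶜ := by
        ext y
        simp only [outerBoundary, mem_filter, mem_univ, true_and, mem_compl]
        exact ⟨And.left, fun h => ⟨h, hw' y h⟩⟩
      rw [this, card_compl, card_singleton]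
      omega
    have hdis : Disjoint (insert v S) (outerBoundary H {v}) := by
      rw [disjoint_left]
      intro x hx hx'
      simp only [outerBoundary, mem_filter, mem_univ, true_and, mem_singleton, exists_eq_left]
        at hx'
      rcases mem_insert.1 hx with rfl | hx
      · exact hx'.1 rfl
      · exact hSv' x hx hx'.2.symm
    have h1 := card_le_univ (insert v S ∪ outerBoundary H {v})
    rw [card_union_of_disjoint hdis, card_insert_of_notMem hvS] at h1
    rw [hBeq, card_compl, card_insert_of_notMem huS]
    omega
  have hR : S ∪ (outerBoundary H (insert u S)).erase v ⊆
      R.toLeft.map (Function.Embedding.subtype _) := by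
    intro y hy
    simp only [mem_map, Function.Embedding.coe_subtype, Subtype.exists, exists_and_right,
      exists_eq_right]
    rcases mem_union.1 hy with hy | hy
    · obtain ⟨h, h'⟩ := (hS y).1 hy
      exact ⟨h, hself h'⟩
    · simp only [outerBoundary, mem_erase, mem_filter, mem_univ, true_and, mem_insert,
        not_or] at hy
      obtain ⟨hyv, ⟨hyu, hyS⟩, x, hx, hxy⟩ := hy
      refine ⟨⟨hyu, hyv⟩, mem_toLeft.2 (mem_filter.2 ⟨mem_univ _, ?_⟩)⟩
      rcases hx with rfl | hx
      · exact ⟨_, mem_toRight.1 hi₀, hxy⟩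
      · obtain ⟨h, h'⟩ := (hS x).1 hx
        exact ⟨_, mem_toLeft.1 h', Or.inr hxy⟩
  have h1 := card_le_card hR
  rw [card_map, card_union_of_disjoint, card_map] at h1
  swap
  · rw [disjoint_left]
    intro x hx hx'
    simp only [outerBoundary, mem_erase, mem_filter, mem_univ, true_and, mem_insert,
      not_or] at hx'
    exact hx'.2.1.2 hx
  -- If `uv` is an edge, `v` is lost from the boundary. This matters only when `A` contains all
  -- copies, and then copy 0 of `v` compensates.
  by_cases hadj : H.Adj u v
  · have h2 := pred_card_le_card_erase (s := outerBoundary H (insert u S)) (a := v)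
    rcases hIk.lt_or_eq with h3 | h3
    · omega
    · have h4 : A.toRight = univ := by
        rw [← card_eq_iff_eq_univ, h3, Fintype.card_fin]
      have hk : 0 < k := i₀.pos
      have h5 : 0 < #R.toRight := card_pos.2 ⟨⟨0, hk⟩, mem_toRight.2 (mem_filter.2
        ⟨mem_univ _, .inr ⟨0, hk⟩, mem_toRight.1 (h4 ▸ mem_univ _), hadj, rfl, rfl⟩)⟩
      omega
  · rw [erase_eq_of_notMem] at h1
    · omega
    · simp only [outerBoundary, mem_filter, mem_univ, true_and, mem_insert, not_and, not_exists]
      rintro - x (rfl | hx)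
      exacts [hadj, hSv' x hx]

/-- The injection is a permutation of a finite set, so the orbit of each copy of `u` returns to the
copies. Up to the first return it traces a walk to `v`, and injectivity keeps different walks apart.
-/
theorem exists_walks {H : SimpleGraph V} {k : ℕ} (hH : IsExpanding H k)
    (hn : k < Fintype.card V) {u v : V} (huv : u ≠ v) :
    ∃ (w : Fin k → H.Walk u v), (∀ i j, i ≠ j → (w i).InternallyDisjoint (w j)) ∧
      ∀ i, i.val ≠ 0 → s(u, v) ∉ (w i).edges := by
  obtain ⟨f, hf, hstep⟩ := exists_injective_stepRel hH hn huv
  have hret : ∀ i : Fin k, ∃ m, 0 < m ∧ ∃ j, f^[m] (.inr i) = .inr j := by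
    intro i
    obtain ⟨m, hm, h⟩ := hf.mem_periodicPts (.inr i)
    exact ⟨m, hm, i, h⟩
  let t : Fin k → ℕ := fun i => Nat.find (hret i)
  have ht0 : ∀ i, 0 < t i := fun i => (Nat.find_spec (hret i)).1
  have htr : ∀ i, ∃ j, f^[t i] (.inr i) = .inr j := fun i => (Nat.find_spec (hret i)).2
  have htmin : ∀ i m, 0 < m → m < t i → ∀ j, f^[m] (.inr i) ≠ .inr j := by
    intro i m hm hlt j h
    exact Nat.find_min (hret i) hlt ⟨hm, j, h⟩
  -- Cancelling `a` iterations exhibits copy `i` as an iterate of copy `j` before its first return,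
  -- which is possible only at time 0.
  have hkey : ∀ i j a b, 0 < a → a ≤ b → b < t j → f^[a] (.inr i) = f^[b] (.inr j) → i = j := by
    intro i j a b ha hab hb h
    rw [show b = a + (b - a) by omega, Function.iterate_add_apply] at h
    have h' := hf.iterate a h
    rcases Nat.eq_zero_or_pos (b - a) with h0 | h0
    · rw [h0] at h'
      exact Sum.inr_injective h'
    · exact absurd h'.symm (htmin j (b - a) h0 (by omega) i)
  let O : Fin k → Set V := fun i => {x | ∃ h a, 0 < a ∧ a < t i ∧ f^[a] (.inr i) = .inl ⟨x, h⟩}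
  have hOdis : ∀ i j x, x ∈ O i → x ∈ O j → i = j := by
    rintro i j x ⟨h, a, ha, hat, hax⟩ ⟨h', b, hb, hbt, hbx⟩
    rcases le_total a b with hab | hab
    · exact hkey i j a b ha hab hbt (hax.trans hbx.symm)
    · exact (hkey j i b a hb hab hat (hbx.trans hax.symm)).symm
  have hwalk : ∀ i a, 0 < a → a < t i → ∀ x, f^[a] (.inr i) = .inl x →
      ∃ w : H.Walk u x, ∀ y ∈ w.support, y = u ∨ y ∈ O i := by
    intro i a ha
    induction a, ha using Nat.le_induction with
    | base =>
      intro hat x hx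
      have h1 := hstep (.inr i)
      have hxO : (x : V) ∈ O i := ⟨x.2, 1, one_pos, hat, hx⟩
      rw [Nat.succ_eq_add_one, zero_add, Function.iterate_one] at hx
      rw [hx] at h1
      change H.Adj u (x : V) at h1
      refine ⟨SimpleGraph.Walk.cons h1 .nil, fun y hy => ?_⟩
      simp only [SimpleGraph.Walk.support_cons, SimpleGraph.Walk.support_nil, List.mem_cons,
        List.not_mem_nil, or_false] at hy
      rcases hy with rfl | rfl
      exacts [Or.inl rfl, Or.inr hxO]
    | succ a ha ih =>
      intro hat x hx
      have hxO : (x : V) ∈ O i := ⟨x.2, a + 1, by omega, hat, hx⟩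
      rw [Function.iterate_succ_apply'] at hx
      rcases hz : f^[a] (.inr i) with z | j
      · obtain ⟨w, hw⟩ := ih (by omega) z hz
        have h1 := hstep (.inl z)
        rw [hz] at hx
        rw [hx] at h1
        rcases h1 with h1 | h1
        · subst h1; exact ⟨w, hw⟩
        · refine ⟨w.concat h1, fun y hy => ?_⟩
          rw [SimpleGraph.Walk.support_concat, List.mem_append, List.mem_singleton] at hy
          rcases hy with hy | rfl
          exacts [hw y hy, Or.inr hxO]
      · exact absurd hz (htmin i a (by omega) (by omega) j)
  have hfull : ∀ i, ∃ w : H.Walk u v, (∀ y ∈ w.support, y = u ∨ y = v ∨ y ∈ O i) ∧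
      (i.val ≠ 0 → s(u, v) ∉ w.edges) := by
    intro i
    obtain ⟨j, hj⟩ := htr i
    have ht := ht0 i
    rw [show t i = (t i - 1) + 1 by omega, Function.iterate_succ_apply'] at hj
    rcases Nat.eq_zero_or_pos (t i - 1) with h0 | h0
    · rw [h0, Function.iterate_zero, id] at hj
      have h1 := hstep (.inr i)
      rw [hj] at h1
      exact ⟨SimpleGraph.Walk.cons h1.1 .nil, by simp, fun h => absurd h1.2.1 h⟩
    · rcases hz : f^[t i - 1] (.inr i) with z | j'
      · obtain ⟨w, hw⟩ := hwalk i (t i - 1) h0 (by omega) z hz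
        have h1 := hstep (.inl z)
        rw [hz] at hj
        rw [hj] at h1
        change H.Adj (z : V) v at h1
        refine ⟨w.concat h1, fun y hy => ?_, fun _ he => ?_⟩
        · rw [SimpleGraph.Walk.support_concat, List.mem_append, List.mem_singleton] at hy
          rcases hy with hy | rfl
          · exact (hw y hy).imp_right Or.inr
          · exact Or.inr (Or.inl rfl)
        · rw [SimpleGraph.Walk.edges_concat, List.concat_eq_append, List.mem_append,
            List.mem_singleton] at he
          rcases he with he | he
          · rcases hw v (w.snd_mem_support_of_mem_edges he) with h | ⟨h, -⟩
            exacts [huv h.symm, h.2 rfl]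
          · rcases Sym2.mem_iff.1 (he ▸ Sym2.mem_mk_left u v : u ∈ s((z : V), v)) with h | h
            exacts [z.2.1 h.symm, huv h]
      · exact absurd hz (htmin i _ h0 (by omega) j')
  choose w hw he using hfull
  refine ⟨w, fun i j hij x hx hx' => ?_, he⟩
  rcases hw i x hx with h | h | h
  · exact Or.inl h
  · exact Or.inr h
  · rcases hw j x hx' with h' | h' | h'
    · exact Or.inl h'
    · exact Or.inr h'
    · exact absurd (hOdis i j x h h') hij

/-- A vertex version of Menger's theorem for expanding graphs. -/
theorem exists_disjoint_paths {H : SimpleGraph V} {k : ℕ} (hH : IsExpanding H k)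
    (hn : k < Fintype.card V) {u v : V} (huv : u ≠ v) :
    ∃ P : Fin k → H.Path u v, Function.Injective P ∧
      ∀ i j, i ≠ j → (P i : H.Walk u v).InternallyDisjoint (P j : H.Walk u v) := by
  obtain ⟨w, hw, he⟩ := exists_walks hH hn huv
  have hdis : ∀ i j, i ≠ j → ((w i).toPath : H.Walk u v).InternallyDisjoint
      ((w j).toPath : H.Walk u v) := fun i j hij x hx hx' =>
    hw i j hij x ((w i).support_bypass_subset_support hx) ((w j).support_bypass_subset_support hx')
  -- Internally disjoint paths coincide only if both are the edge `uv`, which a walk of nonzero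
  -- index avoids.
  have hne : ∀ i j, i.val ≠ 0 → i ≠ j → (w i).toPath ≠ (w j).toPath := by
    intro i j hi hij h
    have hd := hdis i j hij
    rw [← h] at hd
    have hnil : ¬ ((w i).toPath : H.Walk u v).Nil := SimpleGraph.Walk.not_nil_of_ne huv
    rcases hd _ (SimpleGraph.Walk.getVert_mem_support _ 1)
      (SimpleGraph.Walk.getVert_mem_support _ 1) with h1 | h1
    · exact (SimpleGraph.Walk.adj_snd hnil).ne h1.symm
    · have h2 := SimpleGraph.Walk.mk_start_snd_mem_edges hnil
      rw [SimpleGraph.Walk.snd, h1] at h2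
      exact he i hi ((w i).edges_bypass_subset_edges h2)
  refine ⟨fun i => (w i).toPath, fun i j h => ?_, hdis⟩
  by_contra hij
  rcases Nat.eq_zero_or_pos i.val with hi | hi
  · refine hne j i (fun hj => hij (Fin.ext (hi.trans hj.symm))) (Ne.symm hij) h.symm
  · exact hne i j hi.ne' hij h

end

/-! ### Powers of cycles with diagonals -/

section

/-- The residue of an integer modulo `n`. -/
def wrap (n : ℕ) [NeZero n] (z : ℤ) : Fin n :=
  ⟨(z % n).toNat, by
    have h1 : (0 : ℤ) < n := by exact_mod_cast Nat.pos_of_ne_zero (NeZero.ne n)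
    have h2 := Int.emod_nonneg z h1.ne'
    have h3 := Int.emod_lt_of_pos z h1
    omega⟩

variable {n : ℕ} [NeZero n]

theorem wrap_eq_wrap_iff {a b : ℤ} : wrap n a = wrap n b ↔ a ≡ b [ZMOD n] := by
  have h1 : (0 : ℤ) < n := by exact_mod_cast Nat.pos_of_ne_zero (NeZero.ne n)
  have h2 := Int.emod_nonneg a h1.ne'
  have h3 := Int.emod_nonneg b h1.ne'
  rw [Int.ModEq, wrap, wrap, Fin.mk.injEq]
  omega

theorem wrap_val (x : Fin n) : wrap n (x.val : ℤ) = x := by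
  ext
  have : ((x.val : ℤ) % n) = x.val := Int.emod_eq_of_lt (by positivity) (by exact_mod_cast x.2)
  simp [wrap, this]

theorem wrap_add_self (a : ℤ) : wrap n (a + n) = wrap n a := by
  rw [wrap_eq_wrap_iff]
  exact Int.add_modEq_right

theorem wrap_add_congr {a b : ℤ} (h : wrap n a = wrap n b) (c : ℤ) :
    wrap n (a + c) = wrap n (b + c) := by
  rw [wrap_eq_wrap_iff] at h ⊢
  exact h.add_right c

theorem wrap_injOn {a b : ℤ} (h : wrap n a = wrap n b) (hab : |a - b| < n) : a = b := by
  rw [wrap_eq_wrap_iff] at h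
  have h1 := Int.eq_zero_of_abs_lt_dvd h.dvd (by rwa [abs_sub_comm])
  omega

/-- The edges of the `r`-th power of the `n`-cycle. -/
noncomputable def powerEdges (n r : ℕ) [NeZero n] : Finset (Sym2 (Fin n)) :=
  ((univ : Finset (Fin n)) ×ˢ Icc 1 r).image fun x => s(x.1, wrap n (x.1.val + x.2))

/-- A smallest set of longest diagonals covering all vertices of the `n`-cycle. -/
noncomputable def diagonalEdges (n : ℕ) [NeZero n] : Finset (Sym2 (Fin n)) :=
  (range ((n + 1) / 2)).image fun z : ℕ => s(wrap n z, wrap n (z + (n / 2 : ℕ)))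

theorem card_powerEdges_le (n r : ℕ) [NeZero n] : #(powerEdges n r) ≤ n * r :=
  card_image_le.trans (by simp)

theorem card_diagonalEdges_le (n : ℕ) [NeZero n] : #(diagonalEdges n) ≤ (n + 1) / 2 :=
  card_image_le.trans (by simp)

theorem mem_powerEdges {r : ℕ} {a b : ℤ} (h : a < b) (h' : b ≤ a + r) :
    s(wrap n a, wrap n b) ∈ powerEdges n r := by
  refine mem_image.2 ⟨(wrap n a, (b - a).toNat), ?_, ?_⟩
  · simp only [mem_product, mem_univ, true_and, mem_Icc]
    omega
  · have : wrap n (((wrap n a).val : ℤ) + ((b - a).toNat : ℕ)) = wrap n b := by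
      rw [wrap_add_congr (wrap_val (wrap n a))]
      congr 1
      omega
    simp only [this]

theorem mem_diagonalEdges (a : ℤ) :
    s(wrap n a, wrap n (a + (n / 2 : ℕ))) ∈ diagonalEdges n ∨
      s(wrap n a, wrap n (a - (n / 2 : ℕ))) ∈ diagonalEdges n := by
  have hx := wrap_val (wrap n a)
  set x := wrap n a with hxdef
  have hxn := x.2
  by_cases h : x.val < (n + 1) / 2
  · left
    refine mem_image.2 ⟨x.val, mem_range.2 h, ?_⟩
    rw [wrap_add_congr (hx.trans hxdef), hx]
  · right
    refine mem_image.2 ⟨x.val - n / 2, mem_range.2 (by omega), ?_⟩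
    have h1 : ((x.val - n / 2 : ℕ) : ℤ) = (x.val : ℤ) + (-(n / 2 : ℕ) : ℤ) := by omega
    rw [Sym2.eq_swap, h1, neg_add_cancel_right, hx, wrap_add_congr (hx.trans hxdef),
      ← sub_eq_add_neg]

/-- Outer neighbours in a graph that contains a power of the cycle, and possibly long diagonals. -/
theorem isExpanding_power {r : ℕ} {E : Finset (Sym2 (Fin n))} (hE : powerEdges n r ⊆ E)
    {S : Finset (Fin n)} (hS : S.Nonempty) {y : Fin n} (hy : y ∉ S)
    (hyS : ∀ x ∈ S, ¬ (SimpleGraph.fromEdgeSet (E : Set (Sym2 (Fin n)))).Adj x y) :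
    2 * r ≤ #(outerBoundary (SimpleGraph.fromEdgeSet (E : Set (Sym2 (Fin n)))) S) ∧
      (1 ≤ r → 2 * r + 2 ≤ n → diagonalEdges n ⊆ E →
        2 * r + 1 ≤ #(outerBoundary (SimpleGraph.fromEdgeSet (E : Set (Sym2 (Fin n)))) S)) := by
  set H := SimpleGraph.fromEdgeSet (E : Set (Sym2 (Fin n))) with hH
  -- Positions on the cycle are counted from `y`, so `S` lies strictly between 0 and `n`.
  let w : ℤ → Fin n := fun a => wrap n (y.val + a)
  have hw0 : w 0 = y := by simp only [w, add_zero, wrap_val]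
  have hwn : ∀ a, w (a + n) = w a := fun a => by
    simp only [w, ← add_assoc, wrap_add_self]
  have hwinj : ∀ a b : ℤ, w a = w b → |a - b| < n → a = b := fun a b h hab => by
    have := wrap_injOn h (by rwa [add_sub_add_left_eq_sub])
    omega
  have hadj : ∀ a b : ℤ, a < b → b ≤ a + r → w a ≠ w b → H.Adj (w a) (w b) := by
    intro a b h h' hne
    rw [hH, SimpleGraph.fromEdgeSet_adj]
    exact ⟨hE (mem_powerEdges (by omega) (by omega)), hne⟩
  let T : Finset ℕ := {a ∈ range n | w a ∈ S}
  have hT : ∀ a : ℕ, a ∈ T ↔ a < n ∧ w a ∈ S := fun a => by simp [T]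
  have hTne : T.Nonempty := by
    obtain ⟨x, hx⟩ := hS
    have hn : (0 : ℤ) < n := by exact_mod_cast Nat.pos_of_ne_zero (NeZero.ne n)
    have h1 := Int.emod_nonneg ((x.val : ℤ) - y.val) hn.ne'
    have h2 := Int.emod_lt_of_pos ((x.val : ℤ) - y.val) hn
    refine ⟨(((x.val : ℤ) - y.val) % n).toNat, (hT _).2 ⟨by omega, ?_⟩⟩
    have h3 : w ((((x.val : ℤ) - y.val) % n).toNat : ℕ) = x := by
      rw [Int.toNat_of_nonneg h1]
      conv_rhs => rw [← wrap_val x]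
      simp only [w]
      rw [wrap_eq_wrap_iff]
      have := (Int.mod_modEq ((x.val : ℤ) - y.val) n).add_left (y.val : ℤ)
      rwa [add_sub_cancel] at this
    rwa [h3]
  obtain ⟨s₁, hs₁, hmin⟩ := T.exists_min_image id hTne
  obtain ⟨s₂, hs₂, hmax⟩ := T.exists_max_image id hTne
  simp only [id] at hmin hmax
  have h12 := hmin s₂ hs₂
  rw [hT] at hs₁ hs₂
  have hr1 : r < s₁ := by
    by_contra! h
    have h0 : s₁ ≠ 0 := by rintro rfl; exact hy (hw0 ▸ hs₁.2)
    refine hyS _ hs₁.2 (hw0 ▸ (hadj 0 s₁ (by omega) (by omega) ?_).symm)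
    rw [hw0]; exact fun h => hy (h ▸ hs₁.2)
  have hr2 : s₂ + r < n := by
    by_contra! h
    have h1 : w n = y := by rw [← hw0, ← hwn 0, zero_add]
    refine hyS _ hs₂.2 (h1 ▸ hadj s₂ n (by omega) (by omega) ?_)
    rw [h1]; exact fun h => hy (h ▸ hs₂.2)
  -- The `r` positions on either side of the hull of `S`; they are distinct because `y` has no
  -- neighbour in `S`.
  let D : Finset ℕ := Ico (s₁ - r) s₁ ∪ Ioc s₂ (s₂ + r)
  have hD : ∀ a, a ∈ D ↔ s₁ ≤ a + r ∧ a < s₁ ∨ s₂ < a ∧ a ≤ s₂ + r := fun a => by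
    simp only [D, mem_union, mem_Ico, mem_Ioc]; omega
  have hnat : ∀ a b : ℕ, a < n → b < n → w a = w b → a = b := fun a b ha hb h => by
    have := hwinj a b h (by rw [abs_lt]; omega)
    omega
  have hDT : ∀ a : ℕ, a < n → a ∉ T → w a ∉ S := fun a ha h h' => h ((hT a).2 ⟨ha, h'⟩)
  have hDB : D.image (fun a : ℕ => w a) ⊆ outerBoundary H S := by
    intro x hx
    obtain ⟨a, ha, rfl⟩ := mem_image.1 hx
    rw [hD] at ha
    have haT : a ∉ T := fun h => by
      have := hmin a h
      have := hmax a h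
      omega
    have haS := hDT a (by omega) haT
    refine mem_outerBoundary.2 ⟨haS, ?_⟩
    rcases ha with ha | ha
    · exact ⟨w s₁, hs₁.2, (hadj a s₁ (by omega) (by omega) fun h => haS (h ▸ hs₁.2)).symm⟩
    · exact ⟨w s₂, hs₂.2, hadj s₂ a (by omega) (by omega) fun h => haS (h ▸ hs₂.2)⟩
  have hDcard : #(D.image (fun a : ℕ => w a)) = 2 * r := by
    rw [card_image_of_injOn]
    · rw [card_union_of_disjoint, Nat.card_Ico, Nat.card_Ioc]
      · omega
      · rw [disjoint_left]
        intro a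
        simp only [mem_Ico, mem_Ioc]
        omega
    · intro a ha b hb h
      rw [mem_coe, hD] at ha hb
      exact hnat a b (by omega) (by omega) h
  have hle := card_le_card hDB
  rw [hDcard] at hle
  refine ⟨hle, fun hr hrn hdiag => ?_⟩
  by_contra! hlt
  have hBD := eq_of_subset_of_card_le hDB (by omega)
  have hBD' : ∀ a : ℕ, a < n → w a ∈ outerBoundary H S → a ∈ D := by
    intro a ha h
    rw [← hBD] at h
    obtain ⟨b, hb, hab⟩ := mem_image.1 h
    have hb' := (hD b).1 hb
    rwa [← hnat b a (by omega) ha hab]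
  -- The first position of a gap in `S` would be an outer neighbour beyond the `2 * r` in `D`, so
  -- `S` is an interval.
  have hfill : ∀ a, s₁ ≤ a → a ≤ s₂ → a ∈ T := by
    intro a ha
    induction a, ha using Nat.le_induction with
    | base => exact fun _ => (hT _).2 hs₁
    | succ a ha ih =>
      intro ha2
      by_contra hcon
      have haS := ((hT a).1 (ih (by omega))).2
      have ha'S := hDT (a + 1) (by omega) hcon
      have := hBD' (a + 1) (by omega) (mem_outerBoundary.2 ⟨ha'S, w a, haS,
        hadj a (a + 1 : ℕ) (by omega) (by omega) fun h => ha'S (h ▸ haS)⟩)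
      rw [hD] at this
      omega
  have hfar : ∀ a b : ℤ, (s₁ : ℤ) ≤ a → a ≤ s₂ → (s₂ : ℤ) + r < b → b < (n : ℤ) + s₁ - r →
      s(w a, w b) ∉ E := by
    intro a b ha ha2 hb hb2 hab
    have haS : w a ∈ S := by
      have := ((hT a.toNat).1 (hfill a.toNat (by omega) (by omega))).2
      rwa [Int.toNat_of_nonneg (by omega)] at this
    obtain ⟨c, hcn, hc, hcT⟩ : ∃ c : ℕ, c < n ∧ w c = w b ∧ c ∉ T ∧ c ∉ D := by
      rcases lt_or_ge b n with h | h
      · refine ⟨b.toNat, by omega, by rw [Int.toNat_of_nonneg (by omega)], fun h => ?_, ?_⟩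
        · have := hmax _ h
          omega
        · rw [hD]; omega
      · refine ⟨(b - n).toNat, by omega, ?_, fun h => ?_, ?_⟩
        · rw [Int.toNat_of_nonneg (by omega), ← hwn, sub_add_cancel]
        · have := hmin _ h
          omega
        · rw [hD]; omega
    have hcS := hDT c hcn hcT.1
    refine hcT.2 (hBD' c hcn (mem_outerBoundary.2 ⟨hcS, w a, haS, ?_⟩))
    rw [hH, SimpleGraph.fromEdgeSet_adj, hc]
    exact ⟨hab, fun h => hcS (hc ▸ h ▸ haS)⟩
  have hdiag' : ∀ a : ℤ, s(w a, w (a + (n / 2 : ℕ))) ∈ E ∨ s(w a, w (a - (n / 2 : ℕ))) ∈ E := by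
    intro a
    have := mem_diagonalEdges (n := n) (y.val + a)
    rw [add_assoc, add_sub_assoc] at this
    exact this.imp (fun h => hdiag h) (fun h => hdiag h)
  -- Only one of the two diagonals at a position need be present. From a short interval the chosen
  -- `a`, the first position whose forward diagonal passes `s₂ + r`, reaches the far arc in both
  -- directions. Otherwise both diagonals from the first position of the far arc end in `S`.
  by_cases hshort : (s₂ : ℤ) - s₁ ≤ 2 * (n / 2 : ℕ) - 2 * r - 2
  · obtain ⟨a, ha⟩ : ∃ a : ℤ, a = max (s₁ : ℤ) (s₂ + r + 1 - (n / 2 : ℕ)) := ⟨_, rfl⟩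
    rcases hdiag' a with h | h
    · exact hfar a _ (by omega) (by omega) (by omega) (by omega) h
    · rw [← hwn (a - _)] at h
      exact hfar a _ (by omega) (by omega) (by omega) (by omega) h
  · rcases hdiag' (s₂ + r + 1) with h | h
    · rw [← sub_add_cancel (s₂ + r + 1 + ((n / 2 : ℕ) : ℤ)) (n : ℤ), hwn, Sym2.eq_swap] at h
      exact hfar _ _ (by omega) (by omega) (by omega) (by omega) h
    · rw [Sym2.eq_swap] at h
      exact hfar _ _ (by omega) (by omega) (by omega) (by omega) h

/-- There is a sparse graph on `n` vertices in which every nonempty non-dominating vertex set has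
at least `k` outer neighbours. -/
theorem exists_isExpanding {k : ℕ} (hk : 2 ≤ k) (hn : k < n) :
    ∃ H : SimpleGraph (Fin n), IsExpanding H k ∧ 2 * H.edgeSet.ncard ≤ k * n + 1 := by
  have hcard : ∀ E : Finset (Sym2 (Fin n)),
      (SimpleGraph.fromEdgeSet (E : Set (Sym2 (Fin n)))).edgeSet.ncard ≤ #E := by
    intro E
    rw [← Set.ncard_coe_finset, SimpleGraph.edgeSet_fromEdgeSet]
    exact Set.ncard_le_ncard Set.sdiff_subset
  have hp := card_powerEdges_le n (k / 2)
  rcases Nat.even_or_odd' k with ⟨r, rfl | rfl⟩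
  · rw [Nat.mul_div_cancel_left r two_pos] at hp
    refine ⟨SimpleGraph.fromEdgeSet (powerEdges n r : Set (Sym2 (Fin n))), ?_, ?_⟩
    · rintro S hS ⟨y, hy, hyS⟩
      exact (isExpanding_power subset_rfl hS hy hyS).1
    · have := hcard (powerEdges n r)
      have h2 : 2 * r * n = 2 * (n * r) := by ring
      omega
  · rw [show (2 * r + 1) / 2 = r by omega] at hp
    refine ⟨SimpleGraph.fromEdgeSet
      ((powerEdges n r ∪ diagonalEdges n : Finset (Sym2 (Fin n))) : Set (Sym2 (Fin n))), ?_, ?_⟩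
    · rintro S hS ⟨y, hy, hyS⟩
      exact (isExpanding_power subset_union_left hS hy hyS).2 (by omega) (by omega)
        subset_union_right
    · have h1 := hcard (powerEdges n r ∪ diagonalEdges n)
      have h2 := card_union_le (powerEdges n r) (diagonalEdges n)
      have h3 := card_diagonalEdges_le n
      have h4 : (2 * r + 1) * n = 2 * (n * r) + n := by ring
      omega

end

/-! ### The colouring for the lower bound -/

section

theorem card_mem_monochromaticColourCounts {V K : Type*} [Fintype K] {G : SimpleGraph V} {k : ℕ}
    (φ : G.EdgeLabeling K) (hφ : Function.Surjective φ) (hmono : φ.IsMonochromaticConnected k) :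
    Fintype.card K ∈ SimpleGraph.monochromaticColourCounts G k := by
  let e := Fintype.equivFin K
  refine ⟨φ.compRight e, e.surjective.comp hφ, fun u v huv => ?_⟩
  obtain ⟨P, hinj, hdis, hP⟩ := hmono u v huv
  refine ⟨P, hinj, hdis, fun i => ?_⟩
  obtain ⟨c, hc⟩ := hP i
  exact ⟨e c, fun f hf => congrArg e (hc f hf)⟩

/-- Colouring a sparse expanding graph with one colour and giving all other edges different
colours. -/
theorem exists_large_colourCount {n k : ℕ} (hk : 2 ≤ k) (hn : k < n) :
    ∃ r ∈ SimpleGraph.monochromaticColourCounts (⊤ : SimpleGraph (Fin n)) k,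
      2 * n.choose 2 + 2 ≤ 2 * r + k * n + 1 := by
  have : NeZero n := ⟨by omega⟩
  obtain ⟨H, hH, hcard⟩ := exists_isExpanding hk hn
  let R : Set (Sym2 (Fin n)) := (⊤ : SimpleGraph (Fin n)).edgeSet \ H.edgeSet
  have hRcard : n.choose 2 ≤ Nat.card R + H.edgeSet.ncard := by
    have h1 : (⊤ : SimpleGraph (Fin n)).edgeSet.ncard = n.choose 2 := by
      rw [← SimpleGraph.coe_edgeFinset, Set.ncard_coe_finset,
        SimpleGraph.card_edgeFinset_top_eq_card_choose_two, Fintype.card_fin]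
    rw [Nat.card_coe_set_eq, ← h1]
    exact Set.ncard_le_ncard_sdiff_add_ncard _ _
  let φ : (⊤ : SimpleGraph (Fin n)).EdgeLabeling (Option R) := fun e =>
    if h : (e : Sym2 (Fin n)) ∈ H.edgeSet then none else some ⟨e, e.2, h⟩
  have hφ : ∀ e : (⊤ : SimpleGraph (Fin n)).edgeSet, (e : Sym2 (Fin n)) ∈ H.edgeSet → φ e = none := fun e h => by simp [φ, h]
  have hpaths := fun u v (huv : u ≠ v) =>
    exists_disjoint_paths hH (by simpa using hn) (u := u) (v := v) huv
  refine ⟨Fintype.card (Option R), card_mem_monochromaticColourCounts φ ?_ ?_, ?_⟩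
  · rintro (- | ⟨e, he, heH⟩)
    -- The common colour is used, since `H` joins two vertices and so has an edge.
    · have h01 : (⟨0, by omega⟩ : Fin n) ≠ ⟨1, by omega⟩ := by simp
      obtain ⟨P, -, -⟩ := hpaths _ _ h01
      have h := (P ⟨0, by omega⟩).1.adj_snd (SimpleGraph.Walk.not_nil_of_ne h01)
      rw [← SimpleGraph.mem_edgeSet] at h
      exact ⟨⟨_, SimpleGraph.edgeSet_mono le_top h⟩, hφ _ h⟩
    · exact ⟨⟨e, he⟩, by simp [φ, heH]⟩
  · intro u v huv
    obtain ⟨P, hinj, hdis⟩ := hpaths u v huv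
    refine ⟨fun i => ⟨(P i : H.Walk u v).mapLe le_top, (P i).2.mapLe le_top⟩, ?_, ?_, ?_⟩
    · intro i j h
      apply hinj
      apply Subtype.ext
      apply SimpleGraph.Walk.ext_support
      have := congrArg (fun p => (Subtype.val p).support) h
      simpa using this
    · intro i j hij x hx hx'
      exact hdis i j hij x (by simpa using hx) (by simpa using hx')
    · intro i
      refine ⟨none, fun e he => hφ _ ?_⟩
      exact (P i : H.Walk u v).edges_subset_edgeSet (by simpa using he)
  · rw [Fintype.card_option, ← Nat.card_eq_fintype_card]
    omega

end

end MonochromaticCover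

end

/-! ### The bounds in ceiling form -/

theorem mainTheorem5 :
    (∀ n k : ℕ, 2 ≤ k → k < n →
      IsGreatest (SimpleGraph.monochromaticColourCounts (⊤ : SimpleGraph (Fin n)) k)
          (SimpleGraph.monochromaticConnectionNumber k (⊤ : SimpleGraph (Fin n))) ∧
      (n.choose 2 : ℤ) - ⌈(k : ℚ) * (n : ℚ) / 2⌉ + 1 ≤
          (SimpleGraph.monochromaticConnectionNumber k (⊤ : SimpleGraph (Fin n)) : ℤ) ∧
      (SimpleGraph.monochromaticConnectionNumber k (⊤ : SimpleGraph (Fin n)) : ℤ) ≤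
          (n.choose 2 : ℤ) -
            ⌈((k : ℚ) - 1) * (n : ℚ) * ((n : ℚ) - 1) / (2 * ((n : ℚ) - 2))⌉ + 1) ∧
    (∀ n k : ℕ, k ∈ ({2, 3, 4, 5} : Set ℕ) → k < n →
      (SimpleGraph.monochromaticConnectionNumber k (⊤ : SimpleGraph (Fin n)) : ℤ) =
          (n.choose 2 : ℤ) - ⌈(k : ℚ) * (n : ℚ) / 2⌉ + 1) := by
  have hgreatest : ∀ n k : ℕ, 2 ≤ k → k < n →
      IsGreatest (SimpleGraph.monochromaticColourCounts (⊤ : SimpleGraph (Fin n)) k)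
        (SimpleGraph.monochromaticConnectionNumber k (⊤ : SimpleGraph (Fin n))) := by
    intro n k hk hn
    obtain ⟨r, hr, -⟩ := MonochromaticCover.exists_large_colourCount hk hn
    exact SimpleGraph.isGreatest_monochromaticConnectionNumber _ _ ⟨r, hr⟩
  have hlower : ∀ n k : ℕ, 2 ≤ k → k < n → (n.choose 2 : ℤ) - ⌈(k : ℚ) * (n : ℚ) / 2⌉ + 1 ≤
      (SimpleGraph.monochromaticConnectionNumber k (⊤ : SimpleGraph (Fin n)) : ℤ) := by
    intro n k hk hn
    obtain ⟨r, hr, hcard⟩ := MonochromaticCover.exists_large_colourCount hk hn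
    have hle := (hgreatest n k hk hn).2 hr
    -- The strict inequality with the ceiling absorbs the rounding that occurs for odd kn.
    have h : (n.choose 2 : ℤ) - r < ⌈(k : ℚ) * (n : ℚ) / 2⌉ := by
      rw [Int.lt_ceil, lt_div_iff₀ two_pos]
      have : ((2 * n.choose 2 + 2 : ℕ) : ℚ) ≤ (2 * r + k * n + 1 : ℕ) := by exact_mod_cast hcard
      push_cast at this ⊢
      linarith
    omega
  refine ⟨fun n k hk hn => ⟨hgreatest n k hk hn, hlower n k hk hn, ?_⟩, fun n k hk hn => ?_⟩
  · have h1 := (MonochromaticCover.colours_le hk hn (hgreatest n k hk hn).1).1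
    generalize SimpleGraph.monochromaticConnectionNumber k (⊤ : SimpleGraph (Fin n)) = r at h1 ⊢
    have h : ⌈((k : ℚ) - 1) * (n : ℚ) * ((n : ℚ) - 1) / (2 * ((n : ℚ) - 2))⌉ ≤
        (n.choose 2 : ℤ) - r + 1 := by
      have hk' : (k : ℚ) + 1 ≤ n := by exact_mod_cast hn
      have hk2 : (2 : ℚ) ≤ k := by exact_mod_cast hk
      have h2 : ((2 * r + k * n + k + 1 : ℕ) : ℚ) ≤ (2 * n.choose 2 + n + 2 : ℕ) := by
        exact_mod_cast h1
      rw [Int.ceil_le, div_le_iff₀ (by linarith)]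
      push_cast at h2 ⊢
      -- (k−1)n(n−1)/(n−2) equals (k−1)n + (k−1) + 2(k−1)/(n−2), and the last term is at most 2
      -- because `k < n`.
      have h3 : (k : ℚ) * n + k + 1 - n ≤ 2 * ((n.choose 2 : ℚ) - r + 1) := by linarith
      have h4 := mul_le_mul_of_nonneg_right h3 (by linarith : (0 : ℚ) ≤ (n : ℚ) - 2)
      linarith
    omega
  · have hk' : 2 ≤ k ∧ k ≤ 5 := by
      simp only [Set.mem_insert_iff, Set.mem_singleton_iff] at hk
      omega
    have h1 := (MonochromaticCover.colours_le hk'.1 hn (hgreatest n k hk'.1 hn).1).2 hk'.2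
    have hl := hlower n k hk'.1 hn
    generalize SimpleGraph.monochromaticConnectionNumber k (⊤ : SimpleGraph (Fin n)) = r at *
    have h : ⌈(k : ℚ) * (n : ℚ) / 2⌉ ≤ (n.choose 2 : ℤ) - r + 1 := by
      rw [Int.ceil_le, div_le_iff₀ two_pos]
      have : ((2 * r + k * n : ℕ) : ℚ) ≤ (2 * n.choose 2 + 2 : ℕ) := by exact_mod_cast h1
      push_cast at this ⊢
      linarith
    omega
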